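/- Let $M$ be a smooth manifold of dimension $n$ (without boundary), let $I\subseteq\mathbb R$ be an interval, and let $g(t)$, $t\in I$, be a family of Riemannian metrics on $M$ that is smooth in $(x,t)\in M\times I$ and solves the Ricci flow $\partial_t g=-2\,\mathrm{Ric}(g(t))$ on $I$ (derivatives in $t$ are one-sided at end points of $I$ that belong to $I$). In a local chart $(x^1,\dots,x^n)$ with $\partial_i=\partial/\partial x^i$, write $g_{ij}=g(\partial_i,\partial_j)$ and $(g^{ij})=(g_{ij})^{-1}$; let $\nabla$ be the Levi-Civita connection of $g(t)$, with curvature tensor $R(X,Y)Z=\nabla_X\nabla_YZ-\nabla_Y\nabla_XZ-\nabla_{[X,Y]}Z$, and set $$R(\partial_i,\partial_j)\partial_l=R^h_{ijl}\,\partial_h,\qquad R_{ijkl}=g_{hk}R^h_{ijl},\qquad R_{ij}=g^{kl}R_{ikjl},$$ summing over repeated indices (so $R_{ijij}>0$ for $i\ne j$ on a round sphere, and $R_{ij}$ are the components of $\mathrm{Ric}$). Let $\Delta=g^{pq}\nabla_p\nabla_q$ be the Laplacian of $g(t)$ acting on tensor fields. Then for every $t\in I$, in every chart of $M$, at every point of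 the chart, and for all indices $i,j,k,l$, the component $R_{ijkl}$ is differentiable in $t$ and $$\partial_t R_{ijkl}=\Delta R_{ijkl}+2\,(B_{ijkl}-B_{ijlk}-B_{iljk}+B_{ikjl})-g^{pq}\,(R_{pjkl}R_{qi}+R_{ipkl}R_{qj}+R_{ijpl}R_{qk}+R_{ijkp}R_{ql}),$$ where $B_{ijkl}=g^{pr}g^{qs}R_{piqj}R_{rksl}$. -/

import Mathlib

open scoped Manifold ContDiff Bundle

noncomputable section

namespace RicciFlow

/-! ### Tensor calculus of a metric in local coordinates

Throughout, `G : EuclideanSpace ℝ (Fin n) → Matrix (Fin n) (Fin n) ℝ` is the matrix `(g_ij)` of the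
components of a Riemannian metric, as a function of the coordinates. -/

section Coordinates

variable {n : ℕ}

/-- The partial derivative `∂f/∂xⁱ`. -/
def pd (i : Fin n) (f : EuclideanSpace ℝ (Fin n) → ℝ) (x : EuclideanSpace ℝ (Fin n)) : ℝ :=
  fderiv ℝ f x (EuclideanSpace.single i 1)

/-- The Christoffel symbol `Γᵏ_ij = ½ gᵏˡ (∂_i g_jl + ∂_j g_il - ∂_l g_ij)` of the Levi-Civita
connection. -/
def christoffel (G : EuclideanSpace ℝ (Fin n) → Matrix (Fin n) (Fin n) ℝ) (k i j : Fin n)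
    (x : EuclideanSpace ℝ (Fin n)) : ℝ :=
  1 / 2 * ∑ l, (G x)⁻¹ k l *
    (pd i (fun y => G y j l) x + pd j (fun y => G y i l) x - pd l (fun y => G y i j) x)

/-- The `k`-th component of the covariant derivative `∇_i V` of the vector field `V = Vᵏ ∂_k` along
the coordinate field `∂_i`. -/
def covDerivVec (G : EuclideanSpace ℝ (Fin n) → Matrix (Fin n) (Fin n) ℝ) (i : Fin n)
    (V : Fin n → EuclideanSpace ℝ (Fin n) → ℝ) (k : Fin n) (x : EuclideanSpace ℝ (Fin n)) : ℝ :=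
  pd i (V k) x + ∑ j, christoffel G k i j x * V j x

/-- The coordinate vector field `∂_l`, through its (constant) components. -/
def coordField (l : Fin n) (k : Fin n) (_x : EuclideanSpace ℝ (Fin n)) : ℝ :=
  if k = l then 1 else 0

/-- The components `Rʰ_ijl` of the curvature tensor,
`R(∂_i, ∂_j) ∂_l = ∇_i ∇_j ∂_l - ∇_j ∇_i ∂_l = Rʰ_ijl ∂_h` (recall that `[∂_i, ∂_j] = 0`). -/
def curvature (G : EuclideanSpace ℝ (Fin n) → Matrix (Fin n) (Fin n) ℝ) (h i j l : Fin n)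
    (x : EuclideanSpace ℝ (Fin n)) : ℝ :=
  covDerivVec G i (covDerivVec G j (coordField l)) h x -
    covDerivVec G j (covDerivVec G i (coordField l)) h x

/-- The components `R_ijkl = g_hk Rʰ_ijl` of the Riemann curvature tensor, that is
`R_ijkl = g(R(∂_i, ∂_j) ∂_l, ∂_k)`; with this convention `R_ijij > 0` for `i ≠ j` on round
spheres. -/
def riemann (G : EuclideanSpace ℝ (Fin n) → Matrix (Fin n) (Fin n) ℝ) (i j k l : Fin n)
    (x : EuclideanSpace ℝ (Fin n)) : ℝ :=
  ∑ h, G x h k * curvature G h i j l x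

/-- The Ricci tensor `R_ij = gᵏˡ R_ikjl`. -/
def ricci (G : EuclideanSpace ℝ (Fin n) → Matrix (Fin n) (Fin n) ℝ) (i j : Fin n)
    (x : EuclideanSpace ℝ (Fin n)) : ℝ :=
  ∑ k, ∑ l, (G x)⁻¹ k l * riemann G i k j l x

/-- The covariant derivative of a covariant tensor field of rank `r` with components
`T_{a_0 … a_{r-1}}`; the index of differentiation is put in front:
`(∇T)_{p a_0 … a_{r-1}} = ∂_p T_{a_0 … a_{r-1}} - ∑_b Γᵐ_{p a_b} T_{a_0 … m … a_{r-1}}`, with `m` in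
place of `a_b`. -/
def covDeriv (G : EuclideanSpace ℝ (Fin n) → Matrix (Fin n) (Fin n) ℝ) {r : ℕ}
    (T : (Fin r → Fin n) → EuclideanSpace ℝ (Fin n) → ℝ) (a : Fin (r + 1) → Fin n)
    (x : EuclideanSpace ℝ (Fin n)) : ℝ :=
  pd (a 0) (T (Fin.tail a)) x -
    ∑ b : Fin r, ∑ m, christoffel G m (a 0) (Fin.tail a b) x *
      T (Function.update (Fin.tail a) b m) x

/-- The (rough) Laplacian `ΔT = g^{pq} ∇_p ∇_q T` of a covariant tensor field. -/
def laplacian (G : EuclideanSpace ℝ (Fin n) → Matrix (Fin n) (Fin n) ℝ) {r : ℕ}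
    (T : (Fin r → Fin n) → EuclideanSpace ℝ (Fin n) → ℝ) (a : Fin r → Fin n)
    (x : EuclideanSpace ℝ (Fin n)) : ℝ :=
  ∑ p, ∑ q, (G x)⁻¹ p q * covDeriv G (covDeriv G T) (Fin.cons p (Fin.cons q a)) x

/-- The Riemann tensor as a covariant tensor field of rank `4`. -/
def riemannTensor (G : EuclideanSpace ℝ (Fin n) → Matrix (Fin n) (Fin n) ℝ) (a : Fin 4 → Fin n)
    (x : EuclideanSpace ℝ (Fin n)) : ℝ :=
  riemann G (a 0) (a 1) (a 2) (a 3) x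

/-- The quadratic curvature term `B_ijkl = g^{pr} g^{qs} R_piqj R_rksl`. -/
def quadB (G : EuclideanSpace ℝ (Fin n) → Matrix (Fin n) (Fin n) ℝ) (i j k l : Fin n)
    (x : EuclideanSpace ℝ (Fin n)) : ℝ :=
  ∑ p, ∑ q, ∑ r, ∑ s, (G x)⁻¹ p r * (G x)⁻¹ q s * riemann G p i q j x * riemann G r k s l x

end Coordinates

/-! ### Families of Riemannian metrics on a manifold -/

section Manifold

variable {n : ℕ} {M : Type*} [TopologicalSpace M] [ChartedSpace (EuclideanSpace ℝ (Fin n)) M]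

/-- The coordinate vector `∂_i` of the chart `e`, at the point with coordinates `x`. -/
def coordVector (e : OpenPartialHomeomorph M (EuclideanSpace ℝ (Fin n))) (i : Fin n)
    (x : EuclideanSpace ℝ (Fin n)) : TangentSpace (𝓡 n) (e.symm x) :=
  mfderiv (𝓡 n) (𝓡 n) e.symm x (EuclideanSpace.single i 1 : EuclideanSpace ℝ (Fin n))

variable [IsManifold (𝓡 n) ∞ M]

/-- Smooth Riemannian metrics on the `n`-dimensional smooth manifold `M`. -/
abbrev Metric (n : ℕ) (M : Type*) [TopologicalSpace M]
    [ChartedSpace (EuclideanSpace ℝ (Fin n)) M] [IsManifold (𝓡 n) ∞ M] :=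
  Bundle.ContMDiffRiemannianMetric (𝓡 n) ∞ (EuclideanSpace ℝ (Fin n))
    (TangentSpace (𝓡 n) : M → Type)

/-- The matrix `g_ij = g(∂_i, ∂_j)` of the metric `g` in the chart `e`, as a function of the
coordinates (meaningful on `e.target`). -/
def metricMatrix (g : Metric n M) (e : OpenPartialHomeomorph M (EuclideanSpace ℝ (Fin n)))
    (x : EuclideanSpace ℝ (Fin n)) : Matrix (Fin n) (Fin n) ℝ :=
  Matrix.of fun i j => g.inner (e.symm x) (coordVector e i x) (coordVector e j x)

/-- The metrics `g t`, `t ∈ I`, depend smoothly on time and space: in every chart the components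
`g_ij(t, x)` are smooth functions of `(t, x)`. -/
def IsSmoothFamily (I : Set ℝ) (g : ℝ → Metric n M) : Prop :=
  ∀ e ∈ IsManifold.maximalAtlas (𝓡 n) ∞ M, ∀ i j : Fin n,
    ContDiffOn ℝ ∞ (fun p : ℝ × EuclideanSpace ℝ (Fin n) => metricMatrix (g p.1) e p.2 i j)
      (I ×ˢ e.target)

/-- `g` is a smooth solution on the time interval `I` of the Ricci flow `∂g/∂t = -2 Ric`. The
equation of tensors is stated through components in charts, and the time derivative is one-sided at
end points of `I` that belong to `I`. -/
structure IsRicciFlow (I : Set ℝ) (g : ℝ → Metric n M) : Prop where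
  smooth : IsSmoothFamily I g
  flow : ∀ t ∈ I, ∀ e ∈ IsManifold.maximalAtlas (𝓡 n) ∞ M, ∀ x ∈ e.target, ∀ i j : Fin n,
    HasDerivWithinAt (fun s => metricMatrix (g s) e x i j)
      (-2 * ricci (metricMatrix (g t) e) i j x) I t

end Manifold

end RicciFlow

end

/-! The computation is algebra in the ring of smooth functions on `I ×ˢ e.target`, where the
coordinate fields act as commuting derivations `d` and `∂ₜ` as a further derivation `δ` commuting
with them. Under a variation `δg`, `δΓ` is a tensor built from first covariant derivatives of `δg`,
and `δRm` is the antisymmetrised covariant derivative of `δΓ` plus a term from the lowered index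
(`var_rm`). For `δg = -2 Ric` this leaves four second derivatives of `Ric`, the commutator of `∇ᵢ`
and `∇ⱼ` on `Ric`, and a product of `Ric` and `Rm`.

The same four second derivatives occur in `ΔRm`. The second Bianchi identity replaces `∇_p∇_q
R_ijkl` by `∇_p∇_i R_qjkl - ∇_p∇_j R_qikl`; once the derivatives are swapped, the trace meets the
divergence of `Rm`, which is a curl of `Ric` by Bianchi again (`hess_div`, `laplacian_rm`). The
swaps produce the `B` terms and two of the Ricci terms (`trace_hess_comm`); the other two Ricci
terms come from the variation side. `evolution_rm` compares the two sides.

To return to the manifold, `dirDeriv` realises the derivations through `fderivWithin`, which covers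
end points of `I`, and the `represents_*` lemmas identify the algebraic tensors with the coordinate
ones. -/

namespace RicciFlow

/-! ### Tensor calculus over a commutative algebra with commuting derivations -/

section Connection

variable {ι A V : Type*} [Fintype ι] [CommRing A] [Algebra ℝ A] [AddCommGroup V] [Module A V]

/-- `D` is a connection on the `A`-module `V` over the derivations `d`. -/
structure IsConnection (d : ι → Derivation ℝ A A) (D : ι → V → V) : Prop where
  add : ∀ p v w, D p (v + w) = D p v + D p w
  leibniz : ∀ p (a : A) v, D p (a • v) = d p a • v + a • D p v

/-- The connection induced on the tensors with one more covariant index, which is put in front. -/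
def slot (Γ : ι → ι → ι → A) (D : ι → V → V) (p : ι) (T : ι → V) (i : ι) : V :=
  D p (T i) - ∑ m, Γ m p i • T m

/-- The second covariant derivative. -/
def hess (Γ : ι → ι → ι → A) (D : ι → V → V) (p q : ι) (v : V) : V :=
  D p (D q v) - ∑ m, Γ m p q • D m v

/-- The curvature `Rʰ_ijl` of the connection with Christoffel symbols `Γ`. -/
def curv (d : ι → Derivation ℝ A A) (Γ : ι → ι → ι → A) (h i j l : ι) : A :=
  d i (Γ h j l) - d j (Γ h i l) + ∑ m, (Γ h i m * Γ m j l - Γ h j m * Γ m i l)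

/-- Contraction of the first two indices. -/
def contract (gi : ι → ι → A) (T : ι → ι → V) : V := ∑ k, ∑ l, gi k l • T k l

variable {d : ι → Derivation ℝ A A} {Γ : ι → ι → ι → A} {D : ι → V → V}

lemma isConnection_base (d : ι → Derivation ℝ A A) :
    IsConnection d (fun p (a : A) => d p a) where
  add p v w := map_add _ _ _
  leibniz p a v := by simp [add_comm, mul_comm]

namespace IsConnection

lemma zero (hD : IsConnection d D) (p : ι) : D p 0 = 0 := by
  simpa using hD.add p 0 0

lemma neg (hD : IsConnection d D) (p : ι) (v : V) : D p (-v) = -D p v := by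
  have := hD.add p v (-v)
  rw [add_neg_cancel, hD.zero] at this
  exact (neg_eq_of_add_eq_zero_right this.symm).symm

lemma sub (hD : IsConnection d D) (p : ι) (v w : V) : D p (v - w) = D p v - D p w := by
  rw [sub_eq_add_neg, hD.add, hD.neg, ← sub_eq_add_neg]

lemma sum (hD : IsConnection d D) {κ : Type*} (s : Finset κ) (p : ι) (f : κ → V) :
    D p (∑ k ∈ s, f k) = ∑ k ∈ s, D p (f k) :=
  map_sum (AddMonoidHom.mk' (D p) (hD.add p)) f s

/-- This closure property lets tensors of any rank be nested functions, with one application of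
`slot` per index. -/
lemma slot (hD : IsConnection d D) (Γ : ι → ι → ι → A) : IsConnection d (slot Γ D) where
  add p v w := by
    funext i
    simp only [RicciFlow.slot, Pi.add_apply, hD.add, smul_add, Finset.sum_add_distrib]
    abel
  leibniz p a v := by
    funext i
    simp only [RicciFlow.slot, Pi.add_apply, Pi.smul_apply, hD.leibniz, smul_sub, Finset.smul_sum,
      smul_comm a]
    abel

end IsConnection

/-- The Ricci identity for a single index: terms with one `Γ` and one `D` are symmetric in `p`, `q`
and cancel, and the rest is curvature. Iteration gives every rank. -/
lemma slot_comm (hD : IsConnection d D) (p q : ι) (T : ι → V) (i : ι) :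
    slot Γ D p (slot Γ D q T) i - slot Γ D q (slot Γ D p T) i =
      D p (D q (T i)) - D q (D p (T i)) - ∑ m, curv d Γ m p q i • T m := by
  have key : ∀ p q, slot Γ D p (slot Γ D q T) i = D p (D q (T i)) - ∑ m, d p (Γ m q i) • T m
      - ∑ m, Γ m q i • D p (T m) - ∑ m, Γ m p i • D q (T m)
      + ∑ m, (∑ k, Γ m q k * Γ k p i) • T m := by
    intro p q
    simp only [slot, hD.sub, hD.sum, hD.leibniz, smul_sub, Finset.sum_sub_distrib,
      Finset.sum_add_distrib, Finset.smul_sum, Finset.sum_smul, smul_smul]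
    rw [Finset.sum_comm (f := fun m k => (Γ m q k * Γ k p i) • T m)]
    simp only [mul_comm (Γ _ p i)]
    abel
  rw [key, key]
  simp only [curv, add_smul, sub_smul, Finset.sum_sub_distrib, Finset.sum_add_distrib]
  abel

lemma hess_comm (hΓ : ∀ k i j, Γ k i j = Γ k j i) (p q : ι) (v : V) :
    hess Γ D p q v - hess Γ D q p v = D p (D q v) - D q (D p v) := by
  simp only [hess, hΓ _ q p]
  abel

/-- The covariant derivative commutes with the contraction by a parallel tensor. -/
lemma slot_contract (hD : IsConnection d D) {gi : ι → ι → A}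
    (hgi : ∀ p k l, d p (gi k l) = -∑ m, Γ k p m * gi m l - ∑ m, Γ l p m * gi k m)
    (p : ι) (T : ι → ι → V) :
    D p (contract gi T) = contract gi (slot Γ (slot Γ D) p T) := by
  simp only [contract, hD.sum, hD.leibniz, slot, hgi, Pi.sub_apply, Finset.sum_apply, Pi.smul_apply,
    smul_sub, sub_smul, neg_smul, Finset.sum_smul, Finset.smul_sum, smul_smul,
    Finset.sum_sub_distrib, Finset.sum_add_distrib, Finset.sum_neg_distrib]
  have h1 : ∑ k, ∑ l, ∑ m, (Γ k p m * gi m l) • T k l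
      = ∑ k, ∑ l, ∑ m, (gi k l * Γ m p k) • T m l := by
    calc _ = ∑ l, ∑ k, ∑ m, (Γ k p m * gi m l) • T k l := Finset.sum_comm
      _ = ∑ l, ∑ m, ∑ k, (Γ k p m * gi m l) • T k l :=
          Finset.sum_congr rfl fun _ _ => Finset.sum_comm
      _ = _ := by rw [Finset.sum_comm]; simp only [mul_comm]
  have h2 : ∑ k, ∑ l, ∑ m, (Γ l p m * gi k m) • T k l
      = ∑ k, ∑ l, ∑ m, (gi k l * Γ m p l) • T k m := by
    refine Finset.sum_congr rfl fun k _ => ?_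
    rw [Finset.sum_comm]; simp only [mul_comm]
  rw [h1, h2]
  abel

/-- Two uses of `slot_contract`; the correction term of `hess` passes through the contraction by
linearity. -/
lemma hess_contract (hD : IsConnection d D) {gi : ι → ι → A}
    (hgi : ∀ p k l, d p (gi k l) = -∑ m, Γ k p m * gi m l - ∑ m, Γ l p m * gi k m)
    (p q : ι) (T : ι → ι → V) :
    hess Γ D p q (contract gi T) = contract gi (hess Γ (slot Γ (slot Γ D)) p q T) := by
  simp only [hess, slot_contract hD hgi]
  simp only [contract, Pi.sub_apply, Finset.sum_apply, Pi.smul_apply, smul_sub, Finset.smul_sum,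
    Finset.sum_sub_distrib, smul_comm (gi _ _)]
  congr 1
  rw [Finset.sum_comm]
  exact Finset.sum_congr rfl fun k _ => Finset.sum_comm

end Connection

/-! ### Bianchi identities for the curvature with one upper index -/

section Bianchi

variable {ι A : Type*} [Fintype ι] [CommRing A] [Algebra ℝ A]
  {d : ι → Derivation ℝ A A} {Γ : ι → ι → ι → A}

lemma curv_antisymm (h i j l : ι) : curv d Γ h i j l = -curv d Γ h j i l := by
  simp only [curv, Finset.sum_sub_distrib]
  abel

lemma curv_bianchi (hΓ : ∀ k i j, Γ k i j = Γ k j i) (h i j l : ι) :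
    curv d Γ h i j l + curv d Γ h j l i + curv d Γ h l i j = 0 := by
  simp only [curv, hΓ _ j i, hΓ _ l i, hΓ _ l j, Finset.sum_sub_distrib]
  abel

/-- The second Bianchi identity for the curvature as an endomorphism-valued two-form. -/
lemma curv_bianchi_deriv (hd : ∀ i j a, d i (d j a) = d j (d i a)) (h p i j l : ι) :
    (d p (curv d Γ h i j l) + ∑ m, (Γ h p m * curv d Γ m i j l - curv d Γ h i j m * Γ m p l)) +
    (d i (curv d Γ h j p l) + ∑ m, (Γ h i m * curv d Γ m j p l - curv d Γ h j p m * Γ m i l)) +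
    (d j (curv d Γ h p i l) + ∑ m, (Γ h j m * curv d Γ m p i l - curv d Γ h p i m * Γ m j l))
      = 0 := by
  -- With connection matrices `a i` and curvature `F = da + a ∧ a`, the claim becomes `dF + [a, F] =
  -- 0`, a noncommutative ring identity once the derivations commute.
  let a : ι → Matrix ι ι A := fun i => Matrix.of fun h l => Γ h i l
  let E : ι → Matrix ι ι A → Matrix ι ι A := fun i X => X.map (d i)
  have Eadd : ∀ i X Y, E i (X + Y) = E i X + E i Y := fun i X Y => by ext; simp [E]
  have Esub : ∀ i X Y, E i (X - Y) = E i X - E i Y := fun i X Y => by ext; simp [E]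
  have Emul : ∀ i X Y, E i (X * Y) = E i X * Y + X * E i Y := fun i X Y => by
    ext
    simp [E, Matrix.mul_apply, Finset.sum_add_distrib, add_comm, mul_comm]
  have Ecomm : ∀ i j X, E i (E j X) = E j (E i X) := fun i j X => by
    ext; simp [E, hd i j]
  let F : ι → ι → Matrix ι ι A := fun i j => E i (a j) - E j (a i) + (a i * a j - a j * a i)
  have hF : ∀ i j h l, curv d Γ h i j l = F i j h l := fun i j h l => by
    simp [F, E, a, curv, Matrix.mul_apply]
  have key : (E p (F i j) + (a p * F i j - F i j * a p)) + (E i (F j p) + (a i * F j p - F j p * a i))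
      + (E j (F p i) + (a j * F p i - F p i * a j)) = 0 := by
    simp only [F, Eadd, Esub, Emul, Ecomm j p, Ecomm i p, Ecomm j i]
    noncomm_ring
  have := congrFun (congrFun key h) l
  simpa [hF, E, a, Matrix.mul_apply] using this

end Bianchi

end RicciFlow

namespace RicciFlow

/-! ### Symmetries of the Riemann tensor of a metric -/

section LeviCivita

variable {ι A : Type*} [Fintype ι] [CommRing A] [Algebra ℝ A]

/-- `Γ` are the Christoffel symbols of the Levi-Civita connection of the metric `g` with inverse
`gi`, over the commuting derivations `d`. -/
structure IsLeviCivita [DecidableEq ι] (d : ι → Derivation ℝ A A) (Γ : ι → ι → ι → A)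
    (g gi : ι → ι → A) : Prop where
  comm : ∀ i j a, d i (d j a) = d j (d i a)
  torsion : ∀ k i j, Γ k i j = Γ k j i
  symm : ∀ i j, g i j = g j i
  inv_symm : ∀ i j, gi i j = gi j i
  inv_mul : ∀ i k, ∑ j, gi i j * g j k = if i = k then 1 else 0
  compat : ∀ p i j, d p (g i j) = ∑ m, Γ m p i * g m j + ∑ m, Γ m p j * g i m

/-- Covariant derivative of tensors of rank two. -/
abbrev cov₂ (d : ι → Derivation ℝ A A) (Γ : ι → ι → ι → A) : ι → (ι → ι → A) → ι → ι → A :=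
  slot Γ (slot Γ fun p a => d p a)

/-- Covariant derivative of tensors of rank four. -/
abbrev cov₄ (d : ι → Derivation ℝ A A) (Γ : ι → ι → ι → A) :
    ι → (ι → ι → ι → ι → A) → ι → ι → ι → ι → A :=
  slot Γ (slot Γ (cov₂ d Γ))

/-- The Riemann tensor `R_ijkl = g_hk Rʰ_ijl`. -/
def rm (d : ι → Derivation ℝ A A) (Γ : ι → ι → ι → A) (g : ι → ι → A) (i j k l : ι) : A :=
  ∑ h, g h k * curv d Γ h i j l

/-- The Ricci tensor `R_ij = gᵏˡ R_ikjl`. -/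
def ric (d : ι → Derivation ℝ A A) (Γ : ι → ι → ι → A) (g gi : ι → ι → A) (i j : ι) : A :=
  ∑ k, ∑ l, gi k l * rm d Γ g i k j l

/-- The pairing of two tensors of rank two that is induced by the inverse metric. -/
def pair (gi X Y : ι → ι → A) : A :=
  ∑ p, ∑ q, ∑ r, ∑ s, gi p r * gi q s * X p q * Y r s

variable {d : ι → Derivation ℝ A A} {Γ : ι → ι → ι → A} {g gi : ι → ι → A}

lemma eq_of_two_mul_eq {a b : A} (h : 2 * a = 2 * b) : a = b := by
  have h2 : IsUnit (2 : A) := by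
    rw [← map_ofNat (algebraMap ℝ A) 2]
    exact (IsUnit.mk0 (2 : ℝ) two_ne_zero).map (algebraMap ℝ A)
  exact h2.mul_left_cancel h

/-- `slot_comm` once per index; the scalar commutator left at the bottom vanishes by `hd`. -/
lemma cov₂_comm (hd : ∀ i j a, d i (d j a) = d j (d i a)) (p q : ι) (T : ι → ι → A) (i j : ι) :
    cov₂ d Γ p (cov₂ d Γ q T) i j - cov₂ d Γ q (cov₂ d Γ p T) i j =
      -∑ m, curv d Γ m p q i * T m j - ∑ m, curv d Γ m p q j * T i m := by
  have h0 := isConnection_base d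
  have h2 := congrFun (slot_comm (Γ := Γ) (h0.slot Γ) p q T i) j
  have h1 := slot_comm (Γ := Γ) h0 p q (T i) j
  simp only [Pi.sub_apply, Finset.sum_apply, Pi.smul_apply, smul_eq_mul] at h1 h2
  rw [h2, h1, hd p q]
  ring

lemma cov₄_comm (hd : ∀ i j a, d i (d j a) = d j (d i a)) (p q : ι) (T : ι → ι → ι → ι → A)
    (i j k l : ι) :
    cov₄ d Γ p (cov₄ d Γ q T) i j k l - cov₄ d Γ q (cov₄ d Γ p T) i j k l =
      -∑ m, curv d Γ m p q i * T m j k l - ∑ m, curv d Γ m p q j * T i m k l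
        - ∑ m, curv d Γ m p q k * T i j m l - ∑ m, curv d Γ m p q l * T i j k m := by
  have h0 := (isConnection_base d).slot Γ |>.slot Γ
  have h2 := congrFun (congrFun (congrFun (slot_comm (Γ := Γ) (h0.slot Γ) p q T i) j) k) l
  have h1 := congrFun (congrFun (slot_comm (Γ := Γ) h0 p q (T i) j) k) l
  have h3 := cov₂_comm (Γ := Γ) hd p q (T i j) k l
  simp only [Pi.sub_apply, Finset.sum_apply, Pi.smul_apply, smul_eq_mul] at h1 h2
  rw [h2, h1, h3]
  ring

lemma rm_antisymm_left (i j k l : ι) : rm d Γ g i j k l = -rm d Γ g j i k l := by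
  simp only [rm, curv_antisymm _ i j, mul_neg, Finset.sum_neg_distrib]

namespace IsLeviCivita

variable [DecidableEq ι]

lemma deriv_inv (H : IsLeviCivita d Γ g gi) (p k l : ι) :
    d p (gi k l) = -∑ m, Γ k p m * gi m l - ∑ m, Γ l p m * gi k m := by
  let G : Matrix ι ι A := Matrix.of g
  let Gi : Matrix ι ι A := Matrix.of gi
  let P : Matrix ι ι A := Matrix.of fun k m => Γ k p m
  have h1 : Gi * G = 1 := by
    ext i j
    simp [Gi, G, Matrix.mul_apply, H.inv_mul, Matrix.one_apply]
  have h2 : G * Gi = 1 := mul_eq_one_comm.mp h1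
  have h3 : G.map (d p) = P.transpose * G + G * P := by
    ext i j
    simp [G, P, Matrix.mul_apply, H.compat, mul_comm]
  have h4 : Gi.map (d p) * G + Gi * G.map (d p) = 0 := by
    have : (Gi * G).map (d p) = Gi.map (d p) * G + Gi * G.map (d p) := by
      ext
      simp [Matrix.mul_apply, Finset.sum_add_distrib, mul_comm]
    rw [← this, h1]
    ext i j
    by_cases h : i = j <;> simp [h]
  have h5 : Gi.map (d p) = -(P * Gi) - Gi * P.transpose := by
    -- Multiplying the differentiated relation `Gi * G = 1` by `Gi` on the right isolates the
    -- derivative of `Gi`.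
    have h6 : (Gi.map (d p) * G + Gi * G.map (d p)) * Gi = 0 := by rw [h4, zero_mul]
    rw [h3, add_mul, mul_assoc, h2, mul_one, mul_add, add_mul, ← mul_assoc Gi G P, h1, one_mul,
      mul_assoc Gi _ Gi, mul_assoc P.transpose G Gi, h2, mul_one] at h6
    rw [eq_neg_of_add_eq_zero_left h6]
    abel
  have := congrFun (congrFun h5 k) l
  simpa [Gi, P, Matrix.mul_apply, mul_comm] using this

lemma cov_metric (H : IsLeviCivita d Γ g gi) (p : ι) : cov₂ d Γ p g = 0 := by
  funext i j
  simp [slot, H.compat]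

/-- The metric is parallel, so the commutator of covariant derivatives kills it; the Ricci identity
for `g` is then exactly the antisymmetry. -/
lemma rm_antisymm_right (H : IsLeviCivita d Γ g gi) (i j k l : ι) :
    rm d Γ g i j k l = -rm d Γ g i j l k := by
  have h := cov₂_comm (Γ := Γ) H.comm i j g k l
  have h0 := (isConnection_base d).slot Γ |>.slot Γ
  rw [H.cov_metric, H.cov_metric, show cov₂ d Γ i 0 = 0 from h0.zero i,
    show cov₂ d Γ j 0 = 0 from h0.zero j] at h
  simp only [rm, H.symm _ k, H.symm _ l]
  simp only [Pi.zero_apply, H.symm _ l] at h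
  simp only [mul_comm (g _ _)]
  linear_combination h

lemma rm_bianchi (H : IsLeviCivita d Γ g gi) (i j k l : ι) :
    rm d Γ g i j k l + rm d Γ g j l k i + rm d Γ g l i k j = 0 := by
  simp only [rm, ← Finset.sum_add_distrib, ← mul_add, curv_bianchi H.torsion, mul_zero,
    Finset.sum_const_zero]

/-- The classical combination of cyclic identities with both antisymmetries; it yields the claim
doubled, hence the cancellation of `2`. -/
lemma rm_pair_symm (H : IsLeviCivita d Γ g gi) (i j k l : ι) :
    rm d Γ g i j k l = rm d Γ g k l i j := by
  have a := fun i j k l => rm_antisymm_left (d := d) (Γ := Γ) (g := g) i j k l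
  have b := H.rm_antisymm_right
  have c := H.rm_bianchi
  refine eq_of_two_mul_eq ?_
  generalize rm d Γ g = R at *
  grind

lemma curv_eq (H : IsLeviCivita d Γ g gi) (m p q i : ι) :
    curv d Γ m p q i = ∑ s, gi m s * rm d Γ g p q s i := by
  simp only [rm, Finset.mul_sum, ← mul_assoc]
  rw [Finset.sum_comm]
  simp only [← Finset.sum_mul]
  have : ∀ h, ∑ s, gi m s * g h s = if m = h then 1 else 0 := fun h => by
    simp only [H.symm h, H.inv_mul]
  simp [this]

lemma ric_symm (H : IsLeviCivita d Γ g gi) (i j : ι) : ric d Γ g gi i j = ric d Γ g gi j i := by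
  simp only [ric]
  rw [Finset.sum_comm]
  simp only [H.rm_pair_symm i _ j, H.inv_symm _ _]

/-- Since `g` is parallel, lowering commutes with differentiation. The indices `h`, `l` are grouped
as an endomorphism to match `curv_bianchi_deriv`. -/
lemma cov_rm (H : IsLeviCivita d Γ g gi) (p i j k l : ι) :
    cov₄ d Γ p (rm d Γ g) i j k l =
      ∑ h, g h k * (d p (curv d Γ h i j l)
        + ∑ m, (Γ h p m * curv d Γ m i j l - curv d Γ h i j m * Γ m p l))
      - ∑ m, Γ m p i * rm d Γ g m j k l - ∑ m, Γ m p j * rm d Γ g i m k l := by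
  simp only [slot, rm, map_sum, Derivation.leibniz, H.compat, Pi.sub_apply, Finset.sum_apply,
    Pi.smul_apply, smul_eq_mul, Finset.sum_add_distrib, Finset.sum_sub_distrib, mul_add, mul_sub,
    Finset.mul_sum]
  have h1 : ∑ h, ∑ m, curv d Γ h i j l * (Γ m p h * g m k)
      = ∑ h, ∑ m, g h k * (Γ h p m * curv d Γ m i j l) := by
    rw [Finset.sum_comm]
    exact Finset.sum_congr rfl fun _ _ => Finset.sum_congr rfl fun _ _ => by ring
  have h2 : ∑ h, ∑ m, curv d Γ h i j l * (Γ m p k * g h m)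
      = ∑ m, ∑ h, Γ m p k * (g h m * curv d Γ h i j l) := by
    rw [Finset.sum_comm]
    exact Finset.sum_congr rfl fun _ _ => Finset.sum_congr rfl fun _ _ => by ring
  have h3 : ∑ m, ∑ h, Γ m p l * (g h k * curv d Γ h i j m)
      = ∑ h, ∑ m, g h k * (curv d Γ h i j m * Γ m p l) := by
    rw [Finset.sum_comm]
    exact Finset.sum_congr rfl fun _ _ => Finset.sum_congr rfl fun _ _ => by ring
  rw [h1, h2, h3]
  ring

/-- The second Bianchi identity. -/
lemma rm_bianchi_deriv (H : IsLeviCivita d Γ g gi) (p i j k l : ι) :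
    cov₄ d Γ p (rm d Γ g) i j k l + cov₄ d Γ i (rm d Γ g) j p k l
      + cov₄ d Γ j (rm d Γ g) p i k l = 0 := by
  have h := fun h => congrArg (fun a => g h k * a) (curv_bianchi_deriv (Γ := Γ) H.comm h p i j l)
  have h' := Finset.sum_congr (rfl : Finset.univ = Finset.univ) fun m _ => h m
  simp only [mul_add (g _ _) (_ + _), mul_zero, Finset.sum_const_zero, Finset.sum_add_distrib] at h'
  -- The corrections in the two-form indices are absent from `curv_bianchi_deriv`; they cancel in
  -- pairs by this antisymmetry and the vanishing torsion.
  have e : ∀ a b c, ∑ m, Γ m a b * rm d Γ g c m k l = -∑ m, Γ m a b * rm d Γ g m c k l := by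
    intro a b c
    simp only [rm_antisymm_left c, mul_neg, Finset.sum_neg_distrib]
  simp only [H.cov_rm, e, H.torsion _ i p, H.torsion _ j p, H.torsion _ j i]
  linear_combination h'

end IsLeviCivita

end LeviCivita

end RicciFlow

namespace RicciFlow

/-! ### The Laplacian of the Riemann tensor -/

section Evolution

variable {ι A : Type*} [Fintype ι] [CommRing A] [Algebra ℝ A]
  {d : ι → Derivation ℝ A A} {Γ : ι → ι → ι → A} {g gi : ι → ι → A}

/-- Second covariant derivative of tensors of rank two. -/
abbrev hess₂ (d : ι → Derivation ℝ A A) (Γ : ι → ι → ι → A) :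
    ι → ι → (ι → ι → A) → ι → ι → A :=
  hess Γ (cov₂ d Γ)

/-- Second covariant derivative of tensors of rank four. -/
abbrev hess₄ (d : ι → Derivation ℝ A A) (Γ : ι → ι → ι → A) :
    ι → ι → (ι → ι → ι → ι → A) → ι → ι → ι → ι → A :=
  hess Γ (cov₄ d Γ)

lemma isConnection_cov₂ : IsConnection d (cov₂ d Γ) :=
  (isConnection_base d).slot Γ |>.slot Γ

lemma cov₂_apply (p : ι) (T : ι → ι → A) (i j : ι) :
    cov₂ d Γ p T i j = d p (T i j) - ∑ m, Γ m p j * T i m - ∑ m, Γ m p i * T m j := by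
  simp [slot]

lemma cov₄_apply (p : ι) (T : ι → ι → ι → ι → A) (i j k l : ι) :
    cov₄ d Γ p T i j k l = d p (T i j k l) - ∑ m, Γ m p l * T i j k m - ∑ m, Γ m p k * T i j m l
      - ∑ m, Γ m p j * T i m k l - ∑ m, Γ m p i * T m j k l := by
  simp [slot]

lemma hess₂_apply (p q : ι) (T : ι → ι → A) (i j : ι) :
    hess₂ d Γ p q T i j = cov₂ d Γ p (cov₂ d Γ q T) i j - ∑ m, Γ m p q * cov₂ d Γ m T i j := by
  simp [hess]

lemma hess₄_apply (p q : ι) (T : ι → ι → ι → ι → A) (i j k l : ι) :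
    hess₄ d Γ p q T i j k l =
      cov₄ d Γ p (cov₄ d Γ q T) i j k l - ∑ m, Γ m p q * cov₄ d Γ m T i j k l := by
  simp [hess]

lemma hess₂_symm (p q : ι) {T : ι → ι → A} (hT : ∀ i j, T i j = T j i) (i j : ι) :
    hess₂ d Γ p q T i j = hess₂ d Γ p q T j i := by
  have h : ∀ p {T T' : ι → ι → A}, (∀ i j, T i j = T' j i) →
      ∀ i j, cov₂ d Γ p T i j = cov₂ d Γ p T' j i := by
    intro p T T' hT i j
    simp only [cov₂_apply, hT]
    ring
  rw [hess₂_apply, hess₂_apply, h p (h q hT)]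
  simp only [h _ hT i j]

lemma hess₄_antisymm (p q : ι) {T : ι → ι → ι → ι → A} (hT : ∀ i j k l, T i j k l = -T j i k l)
    (i j k l : ι) : hess₄ d Γ p q T i j k l = -hess₄ d Γ p q T j i k l := by
  have h : ∀ p (T : ι → ι → ι → ι → A),
      cov₄ d Γ p (fun i j => -T j i) = fun i j => -cov₄ d Γ p T j i := by
    intro p T
    funext i j k l
    simp only [cov₄_apply, Pi.neg_apply, map_neg, mul_neg, Finset.sum_neg_distrib]
    ring
  conv_lhs => rw [show T = fun i j => -T j i from funext₂ fun i j => funext₂ (hT i j)]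
  simp only [hess₄_apply, h, Pi.neg_apply, mul_neg, Finset.sum_neg_distrib]
  ring

/-- Covariant differentiation of a cyclic identity: the `Γ` corrections of all five indices group
into instances of the same identity. It is applied with `N = ∇Rm`. -/
lemma cov₄_cyclic (a : ι) {N : ι → ι → ι → ι → ι → A}
    (hN : ∀ p i j k l, N p i j k l + N i j p k l + N j p i k l = 0) (p i j k l : ι) :
    (cov₄ d Γ a (N p) i j k l - ∑ m, Γ m a p * N m i j k l)
      + (cov₄ d Γ a (N i) j p k l - ∑ m, Γ m a i * N m j p k l)
      + (cov₄ d Γ a (N j) p i k l - ∑ m, Γ m a j * N m p i k l) = 0 := by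
  have h : ∀ c x y, ∑ m, Γ m a c * N m x y k l + ∑ m, Γ m a c * N x y m k l
      + ∑ m, Γ m a c * N y m x k l = 0 := fun c x y => by
    simp only [← Finset.sum_add_distrib, ← mul_add, hN, mul_zero, Finset.sum_const_zero]
  have hk : ∑ m, Γ m a k * N p i j m l + ∑ m, Γ m a k * N i j p m l
      + ∑ m, Γ m a k * N j p i m l = 0 := by
    simp only [← Finset.sum_add_distrib, ← mul_add, hN, mul_zero, Finset.sum_const_zero]
  have hl : ∑ m, Γ m a l * N p i j k m + ∑ m, Γ m a l * N i j p k m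
      + ∑ m, Γ m a l * N j p i k m = 0 := by
    simp only [← Finset.sum_add_distrib, ← mul_add, hN, mul_zero, Finset.sum_const_zero]
  have hd := congrArg (d a) (hN p i j k l)
  rw [map_add, map_add, map_zero] at hd
  simp only [cov₄_apply]
  linear_combination hd - h p i j - h i j p - h j p i - hk - hl

lemma hess₄_pair_symm (p q : ι) {T : ι → ι → ι → ι → A} (hT : ∀ i j k l, T i j k l = T k l i j)
    (i j k l : ι) : hess₄ d Γ p q T i j k l = hess₄ d Γ p q T k l i j := by
  have h : ∀ p {T : ι → ι → ι → ι → A}, (∀ i j k l, T i j k l = T k l i j) →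
      ∀ i j k l, cov₄ d Γ p T i j k l = cov₄ d Γ p T k l i j := by
    intro p T hT i j k l
    simp only [cov₄_apply, hT i j, hT _ j, hT i _]
    ring
  simp only [hess₄_apply, h p (h q hT) i j, h _ hT i j]

/-- The covariant derivative commutes with the permutation of the indices that brings the second
and the fourth index to the front. -/
lemma cov₄_perm (p : ι) (T : ι → ι → ι → ι → A) :
    cov₄ d Γ p (fun k l i j => T i k j l) = fun k l i j => cov₄ d Γ p T i k j l := by
  funext k l i j
  simp only [cov₄_apply]
  ring

lemma pair_comm (hgi : ∀ i j, gi i j = gi j i) (X Y : ι → ι → A) :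
    pair gi X Y = pair gi Y X := by
  simp only [pair, ← Fintype.sum_prod_type']
  refine Fintype.sum_equiv ⟨fun x => (x.2.2.1, x.2.2.2, x.1, x.2.1),
    fun x => (x.2.2.1, x.2.2.2, x.1, x.2.1), fun _ => rfl, fun _ => rfl⟩ _ _ fun x => ?_
  simp only [Equiv.coe_fn_mk, hgi x.2.2.1, hgi x.2.2.2]
  ring

lemma pair_transpose (X Y : ι → ι → A) :
    pair gi (fun p q => X q p) (fun r s => Y s r) = pair gi X Y := by
  simp only [pair]
  rw [Finset.sum_comm]
  refine Finset.sum_congr rfl fun q _ => Finset.sum_congr rfl fun p _ => ?_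
  rw [Finset.sum_comm]
  refine Finset.sum_congr rfl fun s _ => Finset.sum_congr rfl fun r _ => ?_
  ring

lemma pair_sub_right (X Y Z : ι → ι → A) :
    pair gi X (fun p q => Y p q - Z p q) = pair gi X Y - pair gi X Z := by
  simp only [pair, mul_sub, Finset.sum_sub_distrib]

lemma pair_neg_right (X Y : ι → ι → A) :
    pair gi X (fun p q => -Y p q) = -pair gi X Y := by
  simp only [pair, mul_neg, Finset.sum_neg_distrib]

namespace IsLeviCivita

variable [DecidableEq ι]

/-- `Ric` is a contraction of `Rm` by the parallel tensor `gi`, so traces and derivatives commute.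
-/
lemma hess_ric (H : IsLeviCivita d Γ g gi) (p q i j : ι) :
    hess₂ d Γ p q (ric d Γ g gi) i j = ∑ k, ∑ l, gi k l * hess₄ d Γ p q (rm d Γ g) i k j l := by
  have h : ric d Γ g gi = contract gi (fun k l i j => rm d Γ g i k j l) := by
    funext i j
    simp [ric, contract]
  rw [h, hess₂, hess_contract isConnection_cov₂ H.deriv_inv]
  simp only [contract, Finset.sum_apply, Pi.smul_apply, smul_eq_mul]
  refine Finset.sum_congr rfl fun k _ => Finset.sum_congr rfl fun l _ => ?_
  have h4 : hess Γ (slot Γ (slot Γ (cov₂ d Γ))) p q (fun k l i j => rm d Γ g i k j l) k l i j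
      = hess₄ d Γ p q (rm d Γ g) i k j l := by
    change hess₄ d Γ p q _ k l i j = _
    simp only [hess₄_apply, cov₄_perm]
  rw [h4]

lemma hess_bianchi (H : IsLeviCivita d Γ g gi) (a p i j k l : ι) :
    hess₄ d Γ a p (rm d Γ g) i j k l + hess₄ d Γ a i (rm d Γ g) j p k l
      + hess₄ d Γ a j (rm d Γ g) p i k l = 0 := by
  simp only [hess₄_apply]
  exact cov₄_cyclic a H.rm_bianchi_deriv p i j k l

lemma hess_comm (H : IsLeviCivita d Γ g gi) (p q i j k l : ι) :
    hess₄ d Γ p q (rm d Γ g) i j k l - hess₄ d Γ q p (rm d Γ g) i j k l =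
      -∑ m, curv d Γ m p q i * rm d Γ g m j k l - ∑ m, curv d Γ m p q j * rm d Γ g i m k l
        - ∑ m, curv d Γ m p q k * rm d Γ g i j m l - ∑ m, curv d Γ m p q l * rm d Γ g i j k m := by
  rw [← cov₄_comm H.comm]
  have := congrFun (congrFun (congrFun (congrFun
    (RicciFlow.hess_comm (D := cov₄ d Γ) H.torsion p q (rm d Γ g)) i) j) k) l
  simpa using this

/-- The divergence of the Riemann tensor, differentiated once more. -/
lemma hess_div (H : IsLeviCivita d Γ g gi) (i j k l : ι) :
    ∑ p, ∑ q, gi p q * hess₄ d Γ i p (rm d Γ g) q j k l =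
      hess₂ d Γ i k (ric d Γ g gi) l j - hess₂ d Γ i l (ric d Γ g gi) k j := by
  simp only [H.hess_ric, ← Finset.sum_sub_distrib, ← mul_sub]
  refine Finset.sum_congr rfl fun p _ => Finset.sum_congr rfl fun q _ => ?_
  congr 1
  have ha : ∀ p a b k l, hess₄ d Γ i p (rm d Γ g) a b k l = -hess₄ d Γ i p (rm d Γ g) b a k l :=
    fun p => hess₄_antisymm i p rm_antisymm_left
  -- The identity already holds before tracing: pair symmetry moves `k`, `l` to the front, and
  -- Bianchi is applied to `p`, `k`, `l`.
  have hs := fun p => hess₄_pair_symm (d := d) (Γ := Γ) i p H.rm_pair_symm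
  have hb := H.hess_bianchi i
  obtain ⟨K, hK⟩ : ∃ K, K = fun p => hess₄ d Γ i p (rm d Γ g) := ⟨_, rfl⟩
  have hK' : ∀ p, hess₄ d Γ i p (rm d Γ g) = K p := fun p => by rw [hK]
  simp only [hK'] at ha hs hb ⊢
  clear hK hK'
  grind

lemma trace_curv_mul (H : IsLeviCivita d Γ g gi) (i j : ι) (Y : ι → ι → A) :
    ∑ p, ∑ q, gi p q * ∑ m, curv d Γ m p i j * Y q m
      = pair gi (fun p s => rm d Γ g p i s j) Y := by
  simp only [H.curv_eq, pair, Finset.mul_sum, Finset.sum_mul]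
  refine Finset.sum_congr rfl fun p _ => ?_
  calc _ = ∑ q, ∑ s, ∑ m, gi p q * (gi m s * rm d Γ g p i s j * Y q m) :=
        Finset.sum_congr rfl fun _ _ => Finset.sum_comm
    _ = _ := by
        rw [Finset.sum_comm]
        refine Finset.sum_congr rfl fun s _ => Finset.sum_congr rfl fun q _ =>
          Finset.sum_congr rfl fun m _ => ?_
        rw [H.inv_symm m s]
        ring

/-- Here the trace falls on two indices of the same curvature factor and produces `Ric`; the sign
comes from exchanging `p` and `i`. -/
lemma trace_curv_mul_ric (H : IsLeviCivita d Γ g gi) (i : ι) (Y : ι → A) :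
    ∑ p, ∑ q, gi p q * ∑ m, curv d Γ m p i q * Y m
      = -∑ m, ∑ s, gi m s * (Y m * ric d Γ g gi s i) := by
  simp only [H.ric_symm _ i]
  simp only [H.curv_eq, ric, Finset.mul_sum, Finset.sum_mul, ← Finset.sum_neg_distrib]
  calc _ = ∑ p, ∑ m, ∑ q, ∑ s, gi p q * (gi m s * rm d Γ g p i s q * Y m) :=
        Finset.sum_congr rfl fun _ _ => Finset.sum_comm
    _ = ∑ m, ∑ p, ∑ s, ∑ q, gi p q * (gi m s * rm d Γ g p i s q * Y m) := by
        rw [Finset.sum_comm]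
        exact Finset.sum_congr rfl fun _ _ => Finset.sum_congr rfl fun _ _ => Finset.sum_comm
    _ = ∑ m, ∑ s, ∑ p, ∑ q, gi p q * (gi m s * rm d Γ g p i s q * Y m) :=
        Finset.sum_congr rfl fun _ _ => Finset.sum_comm
    _ = _ := by
        refine Finset.sum_congr rfl fun m _ => Finset.sum_congr rfl fun s _ =>
          Finset.sum_congr rfl fun p _ => Finset.sum_congr rfl fun q _ => ?_
        rw [rm_antisymm_left p i s q]
        ring

/-- The commutator terms in the Laplacian of the Riemann tensor. -/
lemma trace_hess_comm (H : IsLeviCivita d Γ g gi) (i j k l : ι) :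
    ∑ p, ∑ q, gi p q * (hess₄ d Γ p i (rm d Γ g) q j k l - hess₄ d Γ i p (rm d Γ g) q j k l) =
      ∑ p, ∑ q, gi p q * (rm d Γ g p j k l * ric d Γ g gi q i)
        - pair gi (fun p q => rm d Γ g p i q j) (fun r s => rm d Γ g r k s l)
        + pair gi (fun p q => rm d Γ g p i q j) (fun r s => rm d Γ g r l s k)
        - pair gi (fun p q => rm d Γ g p i q k) (fun r s => rm d Γ g r j s l)
        + pair gi (fun p q => rm d Γ g p i q l) (fun r s => rm d Γ g r j s k) := by
  simp only [H.hess_comm, mul_sub, mul_neg, Finset.sum_sub_distrib, Finset.sum_neg_distrib]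
  rw [H.trace_curv_mul_ric i (fun m => rm d Γ g m j k l),
    H.trace_curv_mul i j (fun q m => rm d Γ g q m k l),
    H.trace_curv_mul i k (fun q m => rm d Γ g q j m l),
    H.trace_curv_mul i l (fun q m => rm d Γ g q j k m)]
  -- The first Bianchi identity splits this factor into two of the shape occurring in `B`.
  have h1 : (fun q m => rm d Γ g q m k l) = fun q m => rm d Γ g q k m l - rm d Γ g q l m k := by
    funext q m
    have ha := fun i j k l => rm_antisymm_left (d := d) (Γ := Γ) (g := g) i j k l
    have hs := H.rm_pair_symm
    have hr := H.rm_antisymm_right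
    have hb := H.rm_bianchi
    generalize rm d Γ g = R at *
    grind
  have h2 : (fun q m => rm d Γ g q j k m) = fun q m => -rm d Γ g q j m k := by
    funext q m
    exact H.rm_antisymm_right _ _ _ _
  rw [h1, h2, pair_sub_right, pair_neg_right]
  ring

/-- The Laplacian of the Riemann tensor in terms of second derivatives of the Ricci tensor. -/
lemma laplacian_rm (H : IsLeviCivita d Γ g gi) (i j k l : ι) :
    ∑ p, ∑ q, gi p q * hess₄ d Γ p q (rm d Γ g) i j k l =
      hess₂ d Γ i k (ric d Γ g gi) l j - hess₂ d Γ i l (ric d Γ g gi) k j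
      - hess₂ d Γ j k (ric d Γ g gi) l i + hess₂ d Γ j l (ric d Γ g gi) k i
      + ∑ p, ∑ q, gi p q *
        (hess₄ d Γ p i (rm d Γ g) q j k l - hess₄ d Γ i p (rm d Γ g) q j k l)
      - ∑ p, ∑ q, gi p q *
        (hess₄ d Γ p j (rm d Γ g) q i k l - hess₄ d Γ j p (rm d Γ g) q i k l) := by
  have h : ∀ p q, hess₄ d Γ p q (rm d Γ g) i j k l =
      hess₄ d Γ p i (rm d Γ g) q j k l - hess₄ d Γ p j (rm d Γ g) q i k l := fun p q => by
    have := H.hess_bianchi p q i j k l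
    rw [hess₄_antisymm _ _ rm_antisymm_left j q] at this
    linear_combination this
  have h1 := H.hess_div i j k l
  have h2 := H.hess_div j i k l
  simp only [h, mul_sub, Finset.sum_sub_distrib]
  linear_combination h1 - h2

end IsLeviCivita

end Evolution

end RicciFlow

namespace RicciFlow

/-! ### First variation of curvature and the evolution equation -/

section Variation

variable {ι A : Type*} [Fintype ι] [CommRing A] [Algebra ℝ A]
  {d : ι → Derivation ℝ A A} {Γ : ι → ι → ι → A} {g gi : ι → ι → A} {δ : Derivation ℝ A A}

/-- The variation of the Christoffel symbols, with the upper index lowered. -/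
def lowVar (Γ : ι → ι → ι → A) (g : ι → ι → A) (δ : Derivation ℝ A A) (k i j : ι) : A :=
  ∑ m, g k m * δ (Γ m i j)

/-- Covariant derivative of tensors of rank three. -/
abbrev cov₃ (d : ι → Derivation ℝ A A) (Γ : ι → ι → ι → A) :
    ι → (ι → ι → ι → A) → ι → ι → ι → A :=
  slot Γ (cov₂ d Γ)

lemma cov₃_apply (p : ι) (T : ι → ι → ι → A) (i j k : ι) :
    cov₃ d Γ p T i j k = d p (T i j k) - ∑ m, Γ m p k * T i j m - ∑ m, Γ m p j * T i m k
      - ∑ m, Γ m p i * T m j k := by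
  simp [slot]

namespace IsLeviCivita

variable [DecidableEq ι]

/-- Apply `δ` to metric compatibility: the terms where `δ` falls on `g` complete `d p (δ g)` to a
covariant derivative. -/
lemma cov_var (H : IsLeviCivita d Γ g gi) (hδ : ∀ i a, δ (d i a) = d i (δ a)) (p i j : ι) :
    cov₂ d Γ p (fun i j => δ (g i j)) i j = lowVar Γ g δ j p i + lowVar Γ g δ i p j := by
  have h := congrArg δ (H.compat p i j)
  rw [hδ] at h
  simp only [cov₂_apply, h, lowVar, map_add, map_sum, Derivation.leibniz, smul_eq_mul,
    Finset.sum_add_distrib, H.symm j, mul_comm (g _ _)]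
  ring

/-- The Koszul argument for `δΓ`: alternate `cov_var` over three index orders and use the symmetry
of `δΓ`. -/
lemma two_mul_lowVar (H : IsLeviCivita d Γ g gi) (hδ : ∀ i a, δ (d i a) = d i (δ a))
    (k i j : ι) :
    2 * lowVar Γ g δ k i j = cov₂ d Γ i (fun i j => δ (g i j)) j k
      + cov₂ d Γ j (fun i j => δ (g i j)) i k - cov₂ d Γ k (fun i j => δ (g i j)) i j := by
  have hs : ∀ k i j, lowVar Γ g δ k i j = lowVar Γ g δ k j i := fun k i j => by
    simp only [lowVar, H.torsion _ i j]
  simp only [H.cov_var hδ]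
  linear_combination hs k i j + hs j k i + hs i k j

lemma two_mul_cov_lowVar (H : IsLeviCivita d Γ g gi) (hδ : ∀ i a, δ (d i a) = d i (δ a))
    (p k i j : ι) :
    2 * cov₃ d Γ p (lowVar Γ g δ) k i j = hess₂ d Γ p i (fun i j => δ (g i j)) j k
      + hess₂ d Γ p j (fun i j => δ (g i j)) i k - hess₂ d Γ p k (fun i j => δ (g i j)) i j := by
  have h := H.two_mul_lowVar hδ
  have hd := congrArg (d p) (h k i j)
  rw [two_mul, map_add, ← two_mul] at hd
  simp only [hess₂_apply]
  obtain ⟨N, hN⟩ : ∃ N, N = fun p => cov₂ d Γ p (fun i j => δ (g i j)) := ⟨_, rfl⟩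
  have hN' : ∀ p, cov₂ d Γ p (fun i j => δ (g i j)) = N p := fun p => by rw [hN]
  simp only [hN'] at h hd ⊢
  rw [map_sub, map_add] at hd
  have hm : ∀ f : ι → A, 2 * ∑ m, f m = ∑ m, 2 * f m := fun f => Finset.mul_sum _ _ _
  rw [cov₃_apply, mul_sub, mul_sub, mul_sub, hd, hm, hm, hm]
  simp only [mul_left_comm (2 : A), h, cov₂_apply, mul_add, mul_sub, Finset.sum_add_distrib,
    Finset.sum_sub_distrib]
  ring

/-- Parallelism of `g` absorbs the correction in the lowered index, leaving terms that match `δ` of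
the curvature. -/
lemma cov_lowVar (H : IsLeviCivita d Γ g gi) (p k j l : ι) :
    cov₃ d Γ p (lowVar Γ g δ) k j l =
      ∑ h, g k h * (d p (δ (Γ h j l)) + ∑ m, Γ h p m * δ (Γ m j l))
        - ∑ m, Γ m p j * lowVar Γ g δ k m l - ∑ m, Γ m p l * lowVar Γ g δ k j m := by
  have h1 : d p (lowVar Γ g δ k j l) = ∑ h, g k h * d p (δ (Γ h j l))
      + ∑ h, g k h * ∑ m, Γ h p m * δ (Γ m j l) + ∑ m, Γ m p k * lowVar Γ g δ m j l := by
    simp only [lowVar, map_sum, Derivation.leibniz, smul_eq_mul, H.compat, mul_add,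
      Finset.sum_add_distrib, Finset.mul_sum]
    have e1 : ∑ h, ∑ m, δ (Γ h j l) * (Γ m p k * g m h) =
        ∑ m, ∑ h, Γ m p k * (g m h * δ (Γ h j l)) := by
      rw [Finset.sum_comm]
      exact Finset.sum_congr rfl fun _ _ => Finset.sum_congr rfl fun _ _ => by ring
    have e2 : ∑ h, ∑ m, δ (Γ h j l) * (Γ m p h * g k m) =
        ∑ h, ∑ m, g k h * (Γ h p m * δ (Γ m j l)) := by
      rw [Finset.sum_comm]
      exact Finset.sum_congr rfl fun _ _ => Finset.sum_congr rfl fun _ _ => by ring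
    rw [e1, e2]
    ring
  rw [cov₃_apply, h1]
  simp only [mul_add, Finset.sum_add_distrib]
  ring

/-- The first variation of the Riemann tensor. -/
lemma var_rm (H : IsLeviCivita d Γ g gi) (hδ : ∀ i a, δ (d i a) = d i (δ a)) (i j k l : ι) :
    δ (rm d Γ g i j k l) = ∑ h, δ (g h k) * curv d Γ h i j l
      + (cov₃ d Γ i (lowVar Γ g δ) k j l - cov₃ d Γ j (lowVar Γ g δ) k i l) := by
  have hc : ∀ p q r, ∑ h, g k h * ∑ m, δ (Γ h p m) * Γ m q r
      = ∑ m, Γ m q r * lowVar Γ g δ k p m := by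
    intro p q r
    simp only [lowVar, Finset.mul_sum]
    rw [Finset.sum_comm]
    exact Finset.sum_congr rfl fun _ _ => Finset.sum_congr rfl fun _ _ => by ring
  have h1 := hc i j l
  have h2 := hc j i l
  simp only [H.cov_lowVar]
  simp only [rm, curv, map_sum, map_sub, map_add, Derivation.leibniz, smul_eq_mul, hδ, mul_add,
    mul_sub, add_mul, sub_mul, Finset.sum_add_distrib, Finset.sum_sub_distrib, H.symm _ k,
    H.torsion _ j i, mul_comm (δ (g _ _)), mul_comm (Γ _ _ _) (δ _)] at h1 h2 ⊢
  linear_combination h1 - h2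

lemma ric_lower (H : IsLeviCivita d Γ g gi) (i j k l : ι) :
    ∑ h, ric d Γ g gi h k * curv d Γ h i j l
      = ∑ p, ∑ q, gi p q * (rm d Γ g i j p l * ric d Γ g gi q k) := by
  simp only [H.curv_eq, Finset.mul_sum]
  rw [Finset.sum_comm]
  refine Finset.sum_congr rfl fun p _ => Finset.sum_congr rfl fun q _ => ?_
  rw [H.inv_symm q p]
  ring

/-- The evolution of the Riemann tensor under the Ricci flow. -/
theorem evolution_rm (H : IsLeviCivita d Γ g gi) (hδ : ∀ i a, δ (d i a) = d i (δ a))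
    (flow : ∀ i j, δ (g i j) = -2 * ric d Γ g gi i j) (i j k l : ι) :
    δ (rm d Γ g i j k l) = ∑ p, ∑ q, gi p q * hess₄ d Γ p q (rm d Γ g) i j k l
      + 2 * (pair gi (fun p q => rm d Γ g p i q j) (fun r s => rm d Γ g r k s l)
        - pair gi (fun p q => rm d Γ g p i q j) (fun r s => rm d Γ g r l s k)
        - pair gi (fun p q => rm d Γ g p i q l) (fun r s => rm d Γ g r j s k)
        + pair gi (fun p q => rm d Γ g p i q k) (fun r s => rm d Γ g r j s l))
      - ∑ p, ∑ q, gi p q * (rm d Γ g p j k l * ric d Γ g gi q i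
        + rm d Γ g i p k l * ric d Γ g gi q j + rm d Γ g i j p l * ric d Γ g gi q k
        + rm d Γ g i j k p * ric d Γ g gi q l) := by
  have hh : ∀ p q a b, hess₂ d Γ p q (fun i j => δ (g i j)) a b
      = -2 * hess₂ d Γ p q (ric d Γ g gi) a b := by
    intro p q a b
    -- Writing `-2 Ric` as `-(Ric + Ric)` reduces linearity to additivity of the connection.
    have e : (fun i j => δ (g i j)) = -(ric d Γ g gi + ric d Γ g gi) := by
      funext i j
      simp only [flow, Pi.neg_apply, Pi.add_apply]
      ring
    have e' : ∀ p T, cov₂ d Γ p (-(T + T)) = -(cov₂ d Γ p T + cov₂ d Γ p T) := fun p T => by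
      rw [isConnection_cov₂.neg, isConnection_cov₂.add]
    simp only [hess₂_apply, e, e', Pi.neg_apply, Pi.add_apply, mul_neg, mul_add,
      Finset.sum_neg_distrib, Finset.sum_add_distrib]
    ring
  have hc : ∀ p k i j, cov₃ d Γ p (lowVar Γ g δ) k i j = -hess₂ d Γ p i (ric d Γ g gi) j k
      - hess₂ d Γ p j (ric d Γ g gi) i k + hess₂ d Γ p k (ric d Γ g gi) i j := fun p k i j => by
    refine eq_of_two_mul_eq ?_
    rw [H.two_mul_cov_lowVar hδ]
    simp only [hh]
    ring
  -- This commutator turns the coefficient `-2` of the Ricci term in `k` into `-1` and creates the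
  -- Ricci term in `l`.
  have hcomm : hess₂ d Γ i j (ric d Γ g gi) l k - hess₂ d Γ j i (ric d Γ g gi) l k =
      -∑ h, ric d Γ g gi h k * curv d Γ h i j l - ∑ h, ric d Γ g gi h l * curv d Γ h i j k := by
    have h1 := congrFun (congrFun
      (RicciFlow.hess_comm (D := cov₂ d Γ) H.torsion i j (ric d Γ g gi)) l) k
    simp only [Pi.sub_apply] at h1
    rw [h1, cov₂_comm H.comm]
    simp only [H.ric_symm l, mul_comm (curv _ _ _ _ _ _)]
  have hs : ∀ p q a b, hess₂ d Γ p q (ric d Γ g gi) a b = hess₂ d Γ p q (ric d Γ g gi) b a :=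
    fun p q => hess₂_symm p q H.ric_symm
  have hk : ∑ h, δ (g h k) * curv d Γ h i j l
      = -2 * ∑ h, ric d Γ g gi h k * curv d Γ h i j l := by
    simp only [flow, Finset.mul_sum, mul_assoc]
  have hl : ∑ p, ∑ q, gi p q * (rm d Γ g i j k p * ric d Γ g gi q l) =
      -∑ h, ric d Γ g gi h l * curv d Γ h i j k := by
    simp only [H.ric_lower, ← Finset.sum_neg_distrib, H.rm_antisymm_right i j k, neg_mul, mul_neg]
  have hj : ∑ p, ∑ q, gi p q * (rm d Γ g i p k l * ric d Γ g gi q j) =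
      -∑ p, ∑ q, gi p q * (rm d Γ g p i k l * ric d Γ g gi q j) := by
    simp only [← Finset.sum_neg_distrib, rm_antisymm_left i _ k l, neg_mul, mul_neg]
  -- `B_abce = B_baec`, and below `B_abce = B_ceab`; these make the `i` and `j` commutators
  -- contribute equally, whence the factor `2`.
  have sw : ∀ a b c e, pair gi (fun p q => rm d Γ g p a q b) (fun r s => rm d Γ g r c s e) =
      pair gi (fun p q => rm d Γ g p b q a) (fun r s => rm d Γ g r e s c) := by
    intro a b c e
    rw [← pair_transpose]
    simp only [H.rm_pair_symm _ a _ b, H.rm_pair_symm _ c _ e]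
  have cm : ∀ a b c e, pair gi (fun p q => rm d Γ g p a q b) (fun r s => rm d Γ g r c s e) =
      pair gi (fun p q => rm d Γ g p c q e) (fun r s => rm d Γ g r a s b) :=
    fun a b c e => pair_comm H.inv_symm _ _
  rw [H.var_rm hδ, hc, hc, hk, H.laplacian_rm, H.trace_hess_comm, H.trace_hess_comm]
  simp only [mul_add (gi _ _), Finset.sum_add_distrib]
  rw [hl, hj, ← H.ric_lower i j k l, sw j i k l, sw j i l k, cm j k i l, cm j l i k]
  linear_combination -hcomm - hs i l j k + hs i k j l + hs j l i k - hs j k i l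

end IsLeviCivita

end Variation

end RicciFlow

namespace RicciFlow

/-! ### Existence of the Levi-Civita connection -/

section Christoffel

variable {ι A : Type*} [Fintype ι] [DecidableEq ι] [CommRing A] [Algebra ℝ A]

/-- The Christoffel symbols of the metric `g` with inverse `gi`. -/
noncomputable def leviCivita (d : ι → Derivation ℝ A A) (g gi : ι → ι → A) (k i j : ι) : A :=
  (1 / 2 : ℝ) • ∑ l, gi k l * (d i (g j l) + d j (g i l) - d l (g i j))

lemma isLeviCivita_leviCivita {d : ι → Derivation ℝ A A} {g gi : ι → ι → A}
    (comm : ∀ i j a, d i (d j a) = d j (d i a)) (symm : ∀ i j, g i j = g j i)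
    (inv_symm : ∀ i j, gi i j = gi j i)
    (inv_mul : ∀ i k, ∑ j, gi i j * g j k = if i = k then 1 else 0) :
    IsLeviCivita d (leviCivita d g gi) g gi where
  comm := comm
  symm := symm
  inv_symm := inv_symm
  inv_mul := inv_mul
  torsion k i j := by
    simp only [leviCivita, symm j i]
    congr 2
    funext l
    ring
  compat p i j := by
    -- Lowering the index gives the Koszul expression; two such expressions add up to the derivative
    -- of `g`.
    have low : ∀ i j k, ∑ m, leviCivita d g gi m i j * g m k =
        (1 / 2 : ℝ) • (d i (g j k) + d j (g i k) - d k (g i j)) := by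
      intro i j k
      simp only [leviCivita, smul_mul_assoc, ← Finset.smul_sum, Finset.sum_mul]
      rw [Finset.sum_comm]
      congr 1
      have e : ∀ l, ∑ m, gi m l * g m k = if l = k then 1 else 0 := fun l => by
        rw [← inv_mul l k]
        exact Finset.sum_congr rfl fun m _ => by rw [inv_symm]
      simp only [mul_right_comm _ _ (g _ _), ← Finset.sum_mul, e]
      simp
    have low' : ∑ m, leviCivita d g gi m p j * g i m =
        ∑ m, leviCivita d g gi m p j * g m i := by simp only [symm i]
    rw [low', low, low, ← smul_add, symm j i]
    have : d p (g i j) + d i (g p j) - d j (g p i) + (d p (g i j) + d j (g p i) - d i (g p j))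
        = (2 : ℝ) • d p (g i j) := by
      rw [two_smul]
      ring
    rw [this, smul_smul]
    norm_num

end Christoffel

/-! ### Smooth functions on a set as an algebra with derivations -/

section SmoothFunctions

variable {W : Type*} [NormedAddCommGroup W] [NormedSpace ℝ W] {S : Set W}

/-- The algebra of smooth functions on the set `S`. -/
def smoothAlgebra (S : Set W) : Subalgebra ℝ (S → ℝ) where
  -- Elements are functions on the subtype, so equality is equality on `S` and values elsewhere play
  -- no role.
  carrier := {f | ∃ F : W → ℝ, ContDiffOn ℝ ∞ F S ∧ ∀ p : S, F p = f p}
  mul_mem' := by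
    rintro f f' ⟨F, hF, h⟩ ⟨F', hF', h'⟩
    exact ⟨fun x => F x * F' x, hF.mul hF', fun p => by simp [h, h']⟩
  add_mem' := by
    rintro f f' ⟨F, hF, h⟩ ⟨F', hF', h'⟩
    exact ⟨fun x => F x + F' x, hF.add hF', fun p => by simp [h, h']⟩
  algebraMap_mem' r := ⟨fun _ => r, contDiffOn_const, fun _ => rfl⟩

/-- The extension by zero of a function on `S`. -/
noncomputable def extend (f : smoothAlgebra S) : W → ℝ := Function.extend Subtype.val f.1 0

lemma extend_apply (f : smoothAlgebra S) (p : S) : extend f p = f.1 p :=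
  Subtype.val_injective.extend_apply _ _ _

lemma contDiffOn_extend (f : smoothAlgebra S) : ContDiffOn ℝ ∞ (extend f) S := by
  obtain ⟨F, hF, h⟩ := f.2
  exact hF.congr fun x hx => (extend_apply f ⟨x, hx⟩).trans (h ⟨x, hx⟩).symm

lemma differentiableOn_extend (f : smoothAlgebra S) : DifferentiableOn ℝ (extend f) S :=
  (contDiffOn_extend f).differentiableOn (by simp)

lemma contDiffOn_fderivWithin_extend (hS : UniqueDiffOn ℝ S) (v : W) (f : smoothAlgebra S) :
    ContDiffOn ℝ ∞ (fun x => fderivWithin ℝ (extend f) S x v) S :=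
  ((contDiffOn_extend f).fderivWithin hS (by simp)).clm_apply contDiffOn_const

/-- Differentiation in the direction of `v`, as a derivation of the algebra of smooth functions. -/
noncomputable def dirDeriv (hS : UniqueDiffOn ℝ S) (v : W) :
    Derivation ℝ (smoothAlgebra S) (smoothAlgebra S) :=
  Derivation.mk'
    { toFun := fun f => ⟨fun p => fderivWithin ℝ (extend f) S p v, _,
        contDiffOn_fderivWithin_extend hS v f, fun _ => rfl⟩
      map_add' := fun f f' => by
        ext p
        have e : Set.EqOn (extend (f + f')) (fun x => extend f x + extend f' x) S := fun x hx => by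
          simp only [extend_apply _ ⟨x, hx⟩]
          rfl
        change fderivWithin ℝ (extend (f + f')) S p v =
          fderivWithin ℝ (extend f) S p v + fderivWithin ℝ (extend f') S p v
        rw [fderivWithin_congr e (e p.2), fderivWithin_fun_add (hS p p.2)
          (differentiableOn_extend f p p.2) (differentiableOn_extend f' p p.2)]
        rfl
      map_smul' := fun c f => by
        ext p
        have e : Set.EqOn (extend (c • f)) (fun x => c • extend f x) S := fun x hx => by
          simp only [extend_apply _ ⟨x, hx⟩]
          rfl
        change fderivWithin ℝ (extend (c • f)) S p v = c • fderivWithin ℝ (extend f) S p v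
        rw [fderivWithin_congr e (e p.2), fderivWithin_fun_const_smul (hS p p.2)
          (differentiableOn_extend f p p.2)]
        rfl }
    fun f f' => by
      ext p
      have e : Set.EqOn (extend (f * f')) (fun x => extend f x * extend f' x) S := fun x hx => by
        simp only [extend_apply _ ⟨x, hx⟩]
        rfl
      change fderivWithin ℝ (extend (f * f')) S p v =
        f.1 p * fderivWithin ℝ (extend f') S p v + f'.1 p * fderivWithin ℝ (extend f) S p v
      rw [fderivWithin_congr e (e p.2), fderivWithin_fun_mul (hS p p.2)
        (differentiableOn_extend f p p.2) (differentiableOn_extend f' p p.2),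
        extend_apply, extend_apply]
      rfl

lemma dirDeriv_apply (hS : UniqueDiffOn ℝ S) (v : W) (f : smoothAlgebra S) (p : S) :
    (dirDeriv hS v f).1 p = fderivWithin ℝ (extend f) S p v := rfl

/-- Symmetry of the second derivative within `S`; the closure condition extends it to boundary
points, here the end points of the time interval. -/
lemma dirDeriv_comm (hS : UniqueDiffOn ℝ S) (hS' : S ⊆ closure (interior S)) (v w : W)
    (f : smoothAlgebra S) :
    dirDeriv hS v (dirDeriv hS w f) = dirDeriv hS w (dirDeriv hS v f) := by
  have key : ∀ (v w : W) (p : S), (dirDeriv hS v (dirDeriv hS w f)).1 p =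
      fderivWithin ℝ (fderivWithin ℝ (extend f) S) S p v w := by
    intro v w p
    have e : Set.EqOn (extend (dirDeriv hS w f)) (fun x => fderivWithin ℝ (extend f) S x w) S :=
      fun x hx => extend_apply _ ⟨x, hx⟩
    have hd : DifferentiableWithinAt ℝ (fderivWithin ℝ (extend f) S) S p :=
      ((contDiffOn_extend f).fderivWithin (m := 1) hS (by norm_cast)).differentiableOn
        one_ne_zero p p.2
    rw [dirDeriv_apply, fderivWithin_congr e (e p.2),
      fderivWithin_clm_apply (hS p p.2) hd (differentiableWithinAt_const w)]
    simp
  ext p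
  rw [key, key]
  exact ((contDiffOn_extend f p p.2).isSymmSndFDerivWithinAt (by
    rw [minSmoothness_of_isRCLikeNormedField]
    exact ENat.LEInfty.out) hS (hS' p.2) p.2) v w

lemma isUnit_of_ne_zero {f : smoothAlgebra S} (hf : ∀ p, f.1 p ≠ 0) : IsUnit f := by
  refine IsUnit.of_mul_eq_one ⟨fun p => (f.1 p)⁻¹, fun x => (extend f x)⁻¹,
    (contDiffOn_extend f).inv fun x hx => ?_, fun p => ?_⟩ ?_
  · rw [extend_apply f ⟨x, hx⟩]
    exact hf _
  · simp only [extend_apply]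
  · ext p
    exact mul_inv_cancel₀ (hf p)

/-- Evaluation at a point. -/
def evalAt (p : S) : smoothAlgebra S →ₐ[ℝ] ℝ :=
  (Pi.evalAlgHom ℝ (fun _ : S => ℝ) p).comp (smoothAlgebra S).val

lemma evalAt_injective {f f' : smoothAlgebra S} (h : ∀ p, evalAt p f = evalAt p f') : f = f' :=
  Subtype.ext (funext h)

lemma isUnit_det {ι : Type*} [Fintype ι] [DecidableEq ι] {G : Matrix ι ι (smoothAlgebra S)}
    (hG : ∀ p, (G.map (evalAt p)).det ≠ 0) : IsUnit G.det := by
  refine isUnit_of_ne_zero fun p => ?_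
  have := (evalAt p).toRingHom.map_det G
  exact fun h => hG p (this.symm.trans h)

lemma map_evalAt_inv {ι : Type*} [Fintype ι] [DecidableEq ι] {G : Matrix ι ι (smoothAlgebra S)}
    (hG : ∀ p, (G.map (evalAt p)).det ≠ 0) (p : S) :
    G⁻¹.map (evalAt p) = (G.map (evalAt p))⁻¹ := by
  refine (Matrix.inv_eq_left_inv ?_).symm
  rw [← Matrix.map_mul, Matrix.nonsing_inv_mul _ (isUnit_det hG)]
  exact Matrix.map_one _ (map_zero _) (map_one _)

end SmoothFunctions

/-! ### Time and space derivatives on a product -/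

section SpaceTime

variable {E : Type*} [NormedAddCommGroup E] [NormedSpace ℝ E] {I : Set ℝ} {U : Set E}

lemma hasDerivWithinAt_of_smoothAlgebra (hS : UniqueDiffOn ℝ (I ×ˢ U))
    {a : smoothAlgebra (I ×ˢ U)} {f : ℝ → ℝ} {x : E} (hx : x ∈ U)
    (h : ∀ s (hs : s ∈ I), f s = evalAt (S := I ×ˢ U) ⟨(s, x), hs, hx⟩ a) {t : ℝ} (ht : t ∈ I) :
    HasDerivWithinAt f (evalAt (S := I ×ˢ U) ⟨(t, x), ht, hx⟩ (dirDeriv hS (1, 0) a)) I t := by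
  have h1 : HasFDerivWithinAt (extend a) _ (I ×ˢ U) (t, x) :=
    (differentiableOn_extend a (t, x) ⟨ht, hx⟩).hasFDerivWithinAt
  have h2 : HasDerivWithinAt (fun s : ℝ => (s, x)) (1, 0) I t :=
    (hasDerivWithinAt_id t I).prodMk (hasDerivWithinAt_const t I x)
  have h3 := h1.comp_hasDerivWithinAt t h2 fun s hs => (⟨hs, hx⟩ : (s, x) ∈ I ×ˢ U)
  refine h3.congr (fun s hs => ?_) ?_
  · exact (h s hs).trans (extend_apply a ⟨(s, x), hs, hx⟩).symm
  · exact (h t ht).trans (extend_apply a ⟨(t, x), ht, hx⟩).symm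

/-- The slice `U` is open, so the spatial derivative is a full `fderiv` even when `s` is an end
point of `I`. -/
lemma fderiv_of_smoothAlgebra (hS : UniqueDiffOn ℝ (I ×ˢ U)) (hU : IsOpen U)
    {a : smoothAlgebra (I ×ˢ U)} {f : E → ℝ} {s : ℝ} (hs : s ∈ I)
    (h : ∀ y (hy : y ∈ U), f y = evalAt (S := I ×ˢ U) ⟨(s, y), hs, hy⟩ a) {x : E} (hx : x ∈ U) (v : E) :
    fderiv ℝ f x v = evalAt (S := I ×ˢ U) ⟨(s, x), hs, hx⟩ (dirDeriv hS (0, v) a) := by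
  have h1 : HasFDerivWithinAt (extend a) _ (I ×ˢ U) (s, x) :=
    (differentiableOn_extend a (s, x) ⟨hs, hx⟩).hasFDerivWithinAt
  have h2 : HasFDerivWithinAt (fun y : E => (s, y)) (ContinuousLinearMap.inr ℝ ℝ E) U x :=
    (hasFDerivAt_prodMk_right s x).hasFDerivWithinAt
  have h3 := (h1.comp x h2 (t := I ×ˢ U) fun y hy => ⟨hs, hy⟩).congr (f₁ := f)
    (fun y hy => (h y hy).trans (extend_apply a ⟨(s, y), hs, hy⟩).symm)
    ((h x hx).trans (extend_apply a ⟨(s, x), hs, hx⟩).symm)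
  rw [(h3.hasFDerivAt (hU.mem_nhds hx)).fderiv]
  rfl

end SpaceTime

end RicciFlow

namespace RicciFlow

/-! ### Coordinate tensors as elements of the algebra -/

section Components

variable {n : ℕ} {I : Set ℝ} {U : Set (EuclideanSpace ℝ (Fin n))}

/-- The time-dependent function `f` on `U` is given, for times in `I`, by the smooth function `a` on
`I ×ˢ U`. -/
def Represents (f : ℝ → EuclideanSpace ℝ (Fin n) → ℝ) (a : smoothAlgebra (I ×ˢ U)) : Prop :=
  ∀ s (hs : s ∈ I) y (hy : y ∈ U), f s y = evalAt (S := I ×ˢ U) ⟨(s, y), hs, hy⟩ a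

/-- The coordinate derivations of the algebra of smooth functions on `I ×ˢ U`. -/
noncomputable def coordDeriv (hS : UniqueDiffOn ℝ (I ×ˢ U)) (i : Fin n) :
    Derivation ℝ (smoothAlgebra (I ×ˢ U)) (smoothAlgebra (I ×ˢ U)) :=
  dirDeriv hS (0, EuclideanSpace.single i 1)

lemma Represents.pd {hS : UniqueDiffOn ℝ (I ×ˢ U)} (hU : IsOpen U)
    {f : ℝ → EuclideanSpace ℝ (Fin n) → ℝ} {a : smoothAlgebra (I ×ˢ U)} (h : Represents f a)
    (i : Fin n) : Represents (fun s => pd i (f s)) (coordDeriv hS i a) :=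
  fun s hs _ hy => fderiv_of_smoothAlgebra hS hU hs (h s hs) hy _

lemma covDerivVec_coordField (G : EuclideanSpace ℝ (Fin n) → Matrix (Fin n) (Fin n) ℝ)
    (j l : Fin n) : covDerivVec G j (coordField l) = fun k => christoffel G k j l := by
  funext k x
  have h : pd j (coordField l k) x = 0 := by
    have : coordField l k = fun _ => if k = l then (1 : ℝ) else 0 := rfl
    simp [RicciFlow.pd, this]
  rw [covDerivVec, h]
  simp [coordField]

variable {hS : UniqueDiffOn ℝ (I ×ˢ U)}
  {G : ℝ → EuclideanSpace ℝ (Fin n) → Matrix (Fin n) (Fin n) ℝ}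
  {g gi : Fin n → Fin n → smoothAlgebra (I ×ˢ U)}

lemma represents_christoffel (hU : IsOpen U)
    (hg : ∀ i j, Represents (fun s y => G s y i j) (g i j))
    (hgi : ∀ i j, Represents (fun s y => (G s y)⁻¹ i j) (gi i j)) (k i j : Fin n) :
    Represents (fun s => christoffel (G s) k i j) (leviCivita (coordDeriv hS) g gi k i j) := by
  intro s hs y hy
  have hp := fun i j k => (hg j k).pd (hS := hS) hU i s hs y hy
  have hi := fun i j => hgi i j s hs y hy
  simp only at hp hi
  simp only [christoffel, leviCivita, hp, hi, map_smul, map_sum, map_mul, map_sub, map_add,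
    smul_eq_mul]

variable {Γ : Fin n → Fin n → Fin n → smoothAlgebra (I ×ˢ U)}

lemma represents_curvature (hU : IsOpen U)
    (hΓ : ∀ k i j, Represents (fun s => christoffel (G s) k i j) (Γ k i j)) (h i j l : Fin n) :
    Represents (fun s => curvature (G s) h i j l) (curv (coordDeriv hS) Γ h i j l) := by
  intro s hs y hy
  have hp := fun i k j l => (hΓ k j l).pd (hS := hS) hU i s hs y hy
  have hc := fun k i j => hΓ k i j s hs y hy
  simp only at hp hc
  simp only [curvature, covDerivVec_coordField]
  simp only [covDerivVec, curv, hp, hc, map_sum, map_mul, map_sub, map_add,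
    Finset.sum_sub_distrib]
  ring

lemma represents_riemann (hU : IsOpen U)
    (hg : ∀ i j, Represents (fun s y => G s y i j) (g i j))
    (hΓ : ∀ k i j, Represents (fun s => christoffel (G s) k i j) (Γ k i j)) (i j k l : Fin n) :
    Represents (fun s => riemann (G s) i j k l) (rm (coordDeriv hS) Γ g i j k l) := by
  intro s hs y hy
  have hc := fun h => represents_curvature (hS := hS) hU hΓ h i j l s hs y hy
  have hG := fun i j => hg i j s hs y hy
  simp only at hc hG
  simp only [riemann, rm, hc, hG, map_sum, map_mul]

lemma represents_ricci (hU : IsOpen U)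
    (hg : ∀ i j, Represents (fun s y => G s y i j) (g i j))
    (hgi : ∀ i j, Represents (fun s y => (G s y)⁻¹ i j) (gi i j))
    (hΓ : ∀ k i j, Represents (fun s => christoffel (G s) k i j) (Γ k i j)) (i j : Fin n) :
    Represents (fun s => ricci (G s) i j) (ric (coordDeriv hS) Γ g gi i j) := by
  intro s hs y hy
  have hr := fun i j k l => represents_riemann (hS := hS) hU hg hΓ i j k l s hs y hy
  have hi := fun i j => hgi i j s hs y hy
  simp only at hr hi
  simp only [ricci, ric, hr, hi, map_sum, map_mul]

lemma represents_quadB (hU : IsOpen U)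
    (hg : ∀ i j, Represents (fun s y => G s y i j) (g i j))
    (hgi : ∀ i j, Represents (fun s y => (G s y)⁻¹ i j) (gi i j))
    (hΓ : ∀ k i j, Represents (fun s => christoffel (G s) k i j) (Γ k i j)) (i j k l : Fin n) :
    Represents (fun s => quadB (G s) i j k l)
      (pair gi (fun p q => rm (coordDeriv hS) Γ g p i q j)
        (fun r s => rm (coordDeriv hS) Γ g r k s l)) := by
  intro s hs y hy
  have hr := fun i j k l => represents_riemann (hS := hS) hU hg hΓ i j k l s hs y hy
  have hi := fun i j => hgi i j s hs y hy
  simp only at hr hi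
  simp only [quadB, pair, hr, hi, map_sum, map_mul]

lemma represents_covDeriv_four (hU : IsOpen U)
    (hΓ : ∀ k i j, Represents (fun s => christoffel (G s) k i j) (Γ k i j))
    {T : ℝ → (Fin 4 → Fin n) → EuclideanSpace ℝ (Fin n) → ℝ}
    {τ : Fin n → Fin n → Fin n → Fin n → smoothAlgebra (I ×ˢ U)}
    (hT : ∀ a, Represents (fun s => T s a) (τ (a 0) (a 1) (a 2) (a 3))) (a : Fin 5 → Fin n) :
    Represents (fun s => covDeriv (G s) (T s) a)
      (cov₄ (coordDeriv hS) Γ (a 0) τ (a 1) (a 2) (a 3) (a 4)) := by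
  intro s hs y hy
  have hp := fun i a => (hT a).pd (hS := hS) hU i s hs y hy
  have hc := fun k i j => hΓ k i j s hs y hy
  have ht := fun a => hT a s hs y hy
  simp only at hp hc ht
  simp only [covDeriv, hp, hc, ht, cov₄_apply, map_sub, map_sum, map_mul, Fin.sum_univ_four,
    Function.update_apply, Fin.tail]
  simp
  ring

/-- The second derivative in `laplacian` acts on a rank-five tensor; its front index gives exactly
the correction term of `hess₄`. -/
lemma represents_covDeriv_five (hU : IsOpen U)
    (hΓ : ∀ k i j, Represents (fun s => christoffel (G s) k i j) (Γ k i j))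
    {T : ℝ → (Fin 5 → Fin n) → EuclideanSpace ℝ (Fin n) → ℝ}
    {τ : Fin n → Fin n → Fin n → Fin n → Fin n → smoothAlgebra (I ×ˢ U)}
    (hT : ∀ a, Represents (fun s => T s a) (τ (a 0) (a 1) (a 2) (a 3) (a 4)))
    (a : Fin 6 → Fin n) :
    Represents (fun s => covDeriv (G s) (T s) a)
      (cov₄ (coordDeriv hS) Γ (a 0) (τ (a 1)) (a 2) (a 3) (a 4) (a 5)
        - ∑ m, Γ m (a 0) (a 1) * τ m (a 2) (a 3) (a 4) (a 5)) := by
  intro s hs y hy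
  have hp := fun i a => (hT a).pd (hS := hS) hU i s hs y hy
  have hc := fun k i j => hΓ k i j s hs y hy
  have ht := fun a => hT a s hs y hy
  simp only at hp hc ht
  simp only [covDeriv, hp, hc, ht, cov₄_apply, map_sub, map_sum, map_mul, Fin.sum_univ_five,
    Function.update_apply, Fin.tail]
  simp
  ring

lemma represents_laplacian (hU : IsOpen U)
    (hg : ∀ i j, Represents (fun s y => G s y i j) (g i j))
    (hgi : ∀ i j, Represents (fun s y => (G s y)⁻¹ i j) (gi i j))
    (hΓ : ∀ k i j, Represents (fun s => christoffel (G s) k i j) (Γ k i j)) (i j k l : Fin n) :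
    Represents (fun s => laplacian (G s) (riemannTensor (G s)) ![i, j, k, l])
      (∑ p, ∑ q, gi p q * hess₄ (coordDeriv hS) Γ p q (rm (coordDeriv hS) Γ g) i j k l) := by
  intro s hs y hy
  have h4 := represents_covDeriv_four (hS := hS) hU hΓ (T := fun s => riemannTensor (G s))
    (fun a => represents_riemann (hS := hS) hU hg hΓ (a 0) (a 1) (a 2) (a 3))
  have h5 := fun a => represents_covDeriv_five (hS := hS) hU hΓ
    (τ := fun p => cov₄ (coordDeriv hS) Γ p (rm (coordDeriv hS) Γ g)) h4 a s hs y hy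
  have hi := fun i j => hgi i j s hs y hy
  simp only at h5 hi
  simp only [laplacian, h5, hi, hess₄_apply, map_sum, map_mul]
  rfl

end Components

/-! ### Nondegeneracy of the metric in a chart -/

section Metric

variable {n : ℕ} {M : Type*} [TopologicalSpace M] [ChartedSpace (EuclideanSpace ℝ (Fin n)) M]
  [IsManifold (𝓡 n) ∞ M]

lemma metricMatrix_symm (g : Metric n M)
    (e : OpenPartialHomeomorph M (EuclideanSpace ℝ (Fin n))) (x : EuclideanSpace ℝ (Fin n))
    (i j : Fin n) : metricMatrix g e x i j = metricMatrix g e x j i :=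
  g.symm _ _ _

/-- A kernel vector `v` would give the tangent vector `∑ vᵢ ∂ᵢ` zero length, although it is nonzero
because the derivative of `e.symm` is injective. -/
lemma det_metricMatrix_ne_zero (g : Metric n M)
    {e : OpenPartialHomeomorph M (EuclideanSpace ℝ (Fin n))}
    (he : e ∈ IsManifold.maximalAtlas (𝓡 n) ∞ M) {x : EuclideanSpace ℝ (Fin n)}
    (hx : x ∈ e.target) : (metricMatrix g e x).det ≠ 0 := by
  intro hdet
  obtain ⟨v, hv, hGv⟩ := Matrix.exists_mulVec_eq_zero_iff.mpr hdet
  have hd : e.MDifferentiable (𝓡 n) (𝓡 n) :=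
    ⟨(contMDiffOn_of_mem_maximalAtlas he).mdifferentiableOn (by simp),
      (contMDiffOn_symm_of_mem_maximalAtlas he).mdifferentiableOn (by simp)⟩
  have hinj := hd.symm.mfderiv_injective hx
  let L : EuclideanSpace ℝ (Fin n) →L[ℝ] TangentSpace (𝓡 n) (e.symm x) :=
    mfderiv (𝓡 n) (𝓡 n) e.symm x
  let w : EuclideanSpace ℝ (Fin n) := ∑ i, v i • EuclideanSpace.single i 1
  have hw : L w ≠ 0 := by
    intro h
    have h0 : w = 0 := hinj (h.trans (map_zero L).symm)
    refine hv (funext fun i => ?_)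
    have := congrArg (fun u : EuclideanSpace ℝ (Fin n) => u i) h0
    simpa [w, Pi.single_apply] using this
  refine (g.pos (e.symm x) (L w) hw).ne' ?_
  have hLw : L w = ∑ i, v i • coordVector e i x := by
    simp only [w, map_sum, map_smul]
    rfl
  rw [hLw]
  have h1 : ∀ i, ∑ j, metricMatrix g e x i j * v j = 0 := fun i => congrFun hGv i
  calc _ = ∑ i, v i * ∑ j, metricMatrix g e x i j * v j := by
        simp only [map_sum, map_smul, sum_apply, smul_apply,
          smul_eq_mul, metricMatrix, Matrix.of_apply, Finset.mul_sum]
        refine Finset.sum_congr rfl fun i _ => Finset.sum_congr rfl fun j _ => ?_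
        rw [g.symm]
        ring
    _ = 0 := by simp [h1]

end Metric

end RicciFlow

/-! ### The evolution equation on the manifold -/

namespace RicciFlow

lemma subset_closure_interior {I : Set ℝ} (hI : I.OrdConnected) (hI' : (interior I).Nonempty) :
    I ⊆ closure (interior I) := by
  have hc : Convex ℝ I := hI.convex
  rw [hc.closure_interior_eq_closure_of_nonempty_interior hI']
  exact subset_closure

variable {n : ℕ} {M : Type*} [TopologicalSpace M] [ChartedSpace (EuclideanSpace ℝ (Fin n)) M]
  [IsManifold (𝓡 n) ∞ M]

/-- The evolution equation of the Riemann tensor on a time interval with nonempty interior. -/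
lemma IsRicciFlow.hasDerivWithinAt_riemann {I : Set ℝ} (hI : I.OrdConnected)
    (hI' : (interior I).Nonempty) {g : ℝ → Metric n M} (hg : IsRicciFlow I g) {t : ℝ} (ht : t ∈ I)
    {e : OpenPartialHomeomorph M (EuclideanSpace ℝ (Fin n))}
    (he : e ∈ IsManifold.maximalAtlas (𝓡 n) ∞ M) {x : EuclideanSpace ℝ (Fin n)}
    (hx : x ∈ e.target) (i j k l : Fin n) :
    HasDerivWithinAt (fun s => riemann (metricMatrix (g s) e) i j k l x)
      (laplacian (metricMatrix (g t) e) (riemannTensor (metricMatrix (g t) e)) ![i, j, k, l] x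
        + 2 * (quadB (metricMatrix (g t) e) i j k l x - quadB (metricMatrix (g t) e) i j l k x
          - quadB (metricMatrix (g t) e) i l j k x + quadB (metricMatrix (g t) e) i k j l x)
        - ∑ p, ∑ q, (metricMatrix (g t) e x)⁻¹ p q *
          (riemann (metricMatrix (g t) e) p j k l x * ricci (metricMatrix (g t) e) q i x
            + riemann (metricMatrix (g t) e) i p k l x * ricci (metricMatrix (g t) e) q j x
            + riemann (metricMatrix (g t) e) i j p l x * ricci (metricMatrix (g t) e) q k x
            + riemann (metricMatrix (g t) e) i j k p x * ricci (metricMatrix (g t) e) q l x))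
      I t := by
  set U := e.target
  have hU : IsOpen U := e.open_target
  have hS : UniqueDiffOn ℝ (I ×ˢ U) :=
    (uniqueDiffOn_convex hI.convex hI').prod hU.uniqueDiffOn
  have hS' : I ×ˢ U ⊆ closure (interior (I ×ˢ U)) := by
    rw [interior_prod_eq, closure_prod_eq, hU.interior_eq]
    exact Set.prod_mono (subset_closure_interior hI hI') subset_closure
  let γ : Matrix (Fin n) (Fin n) (smoothAlgebra (I ×ˢ U)) := Matrix.of fun i j =>
    ⟨fun p => metricMatrix (g p.1.1) e p.1.2 i j, _, hg.smooth e he i j, fun _ => rfl⟩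
  have hγ : ∀ p, γ.map (evalAt p) = metricMatrix (g p.1.1) e p.1.2 := fun p => rfl
  have hdet : ∀ p, (γ.map (evalAt p)).det ≠ 0 := fun p => by
    rw [hγ]
    exact det_metricMatrix_ne_zero _ he p.2.2
  let γi : Matrix (Fin n) (Fin n) (smoothAlgebra (I ×ˢ U)) := γ⁻¹
  have rg : ∀ i j, Represents (fun s y => metricMatrix (g s) e y i j) (γ i j) :=
    fun i j s hs y hy => rfl
  have rgi : ∀ i j, Represents (fun s y => (metricMatrix (g s) e y)⁻¹ i j) (γi i j) :=
    fun i j s hs y hy => (congrFun (congrFun (map_evalAt_inv hdet ⟨(s, y), hs, hy⟩) i) j).symm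
  have hsymm : ∀ i j, γ i j = γ j i := fun i j =>
    evalAt_injective fun p => metricMatrix_symm _ _ _ _ _
  have H : IsLeviCivita (coordDeriv hS) (leviCivita (coordDeriv hS) γ γi) γ γi := by
    refine isLeviCivita_leviCivita (fun i j => dirDeriv_comm hS hS' _ _) hsymm (fun i j => ?_)
      fun i k => ?_
    · have hT : γ.transpose = γ := Matrix.ext fun i j => hsymm j i
      have := congrFun (congrFun (Matrix.transpose_nonsing_inv γ) j) i
      rwa [hT] at this
    · rw [← Matrix.mul_apply, Matrix.nonsing_inv_mul _ (isUnit_det hdet), Matrix.one_apply]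
  have rΓ := represents_christoffel (hS := hS) hU rg rgi
  have rRm := represents_riemann (hS := hS) hU rg rΓ
  have rRic := represents_ricci (hS := hS) hU rg rgi rΓ
  have rB := represents_quadB (hS := hS) hU rg rgi rΓ
  have rLap := represents_laplacian (hS := hS) hU rg rgi rΓ i j k l
  have flow : ∀ i j, dirDeriv hS (1, 0) (γ i j) = -2 * ric (coordDeriv hS)
      (leviCivita (coordDeriv hS) γ γi) γ γi i j := by
    intro i j
    refine evalAt_injective fun ⟨⟨s, y⟩, hs, hy⟩ => ?_
    have h1 := hasDerivWithinAt_of_smoothAlgebra hS hy (fun r hr => rg i j r hr y hy) hs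
    -- Both the algebraic `δ` and the flow equation give a derivative within `I`, and such
    -- derivatives are unique on an interval with interior.
    refine ((uniqueDiffOn_convex hI.convex hI' s hs).eq_deriv _ h1
      (hg.flow s hs e he y hy i j)).trans ?_
    have vRic := rRic i j s hs y hy
    simp only at vRic
    simp only [vRic, map_mul, map_neg, map_ofNat]
  have key := H.evolution_rm (δ := dirDeriv hS (1, 0)) (fun i => dirDeriv_comm hS hS' _ _) flow
    i j k l
  have h := hasDerivWithinAt_of_smoothAlgebra hS hx (fun s hs => rRm i j k l s hs x hx) ht
  rw [key] at h
  convert h using 1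
  have vRm := fun i j k l => rRm i j k l t ht x hx
  have vRic := fun i j => rRic i j t ht x hx
  have vB := fun i j k l => rB i j k l t ht x hx
  have vi := fun i j => rgi i j t ht x hx
  have vLap := rLap t ht x hx
  simp only at vRm vRic vB vi vLap
  simp only [vRm, vRic, vB, vi, vLap, map_add, map_sub, map_mul, map_sum, map_ofNat]

end RicciFlow

theorem theorem2p4 {n : ℕ} {M : Type*} [TopologicalSpace M]
    [ChartedSpace (EuclideanSpace ℝ (Fin n)) M] [IsManifold (𝓡 n) ∞ M]
    (I : Set ℝ) (hI : I.OrdConnected) (g : ℝ → RicciFlow.Metric n M)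
    (hg : RicciFlow.IsRicciFlow I g)
    (t : ℝ) (ht : t ∈ I)
    (e : OpenPartialHomeomorph M (EuclideanSpace ℝ (Fin n)))
    (he : e ∈ IsManifold.maximalAtlas (𝓡 n) ∞ M)
    (x : EuclideanSpace ℝ (Fin n)) (hx : x ∈ e.target)
    (G : EuclideanSpace ℝ (Fin n) → Matrix (Fin n) (Fin n) ℝ)
    (hG : G = RicciFlow.metricMatrix (g t) e)
    (i j k l : Fin n) :
    HasDerivWithinAt (fun s => RicciFlow.riemann (RicciFlow.metricMatrix (g s) e) i j k l x)
      (RicciFlow.laplacian G (RicciFlow.riemannTensor G) ![i, j, k, l] x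
        + 2 * (RicciFlow.quadB G i j k l x - RicciFlow.quadB G i j l k x
          - RicciFlow.quadB G i l j k x + RicciFlow.quadB G i k j l x)
        - ∑ p, ∑ q, (G x)⁻¹ p q *
          (RicciFlow.riemann G p j k l x * RicciFlow.ricci G q i x
            + RicciFlow.riemann G i p k l x * RicciFlow.ricci G q j x
            + RicciFlow.riemann G i j p l x * RicciFlow.ricci G q k x
            + RicciFlow.riemann G i j k p x * RicciFlow.ricci G q l x))
      I t := by
  subst hG
  -- On an interval with at most one point every value is a derivative within `I`; otherwise the
  -- interior is nonempty.
  rcases I.subsingleton_or_nontrivial with h | h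
  · exact HasFDerivWithinAt.of_subsingleton h
  · exact hg.hasDerivWithinAt_riemann hI (hI.convex.nontrivial_iff_nonempty_interior.mp h) ht he hx
      i j k l
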